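/- Let $\mathfrak g$ be a complex semisimple Lie algebra with Cartan subalgebra $\mathfrak h$ and a basis $\Pi^+$ of simple roots. Let $(\cdot,\cdot)$ be a non-zero scalar multiple of the Killing form on $\mathfrak h$, transferred to $\mathfrak h^*$. Let $q=e^{\hbar}\in\mathbb C^\times$, with $q^{z}=e^{\hbar z}$, be not a root of unity, and suppose that $q^{(\alpha,\alpha)}$ is not a root of unity for all $\alpha\in\Pi^+$ (this is automatic when the numbers $(\alpha,\alpha)$ are rational). Let $U_q(\mathfrak g)$ be the standard quantum group with generators $e_\alpha,f_\alpha,q^{\pm h_\alpha}$, $\alpha\in\Pi^+$, with $[e_\alpha,f_\beta]=\delta_{\alpha\beta}\frac{q^{h_\alpha}-q^{-h_\alpha}}{q-q^{-1}}$ and the comultiplication $$\Delta(f_\alpha)=f_\alpha\otimes 1+q^{-h_\alpha}\otimes f_\alpha,\quad \Delta(q^{\pm h_\alpha})=q^{\pm h_\alpha}\otimes q^{\pm h_\alpha},\quad \Delta(e_\alpha)=e_\alpha\otimes q^{h_\alpha}+1\otimes e_\alpha .$$ Let $\gamma$ be its antipode, let $\sigma$ be the algebra automorphism $e_\alpha\mapsto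 f_\alpha$, $f_\alpha\mapsto e_\alpha$, $q^{h_\alpha}\mapsto q^{-h_\alpha}$, and put $\omega=\gamma^{-1}\circ\sigma$. Let $U_q(\mathfrak g_\pm)$ be the subalgebras generated by the $e_\alpha$ and by the $f_\alpha$, respectively. Let $V$ and $Z$ be irreducible highest weight $U_q(\mathfrak g)$-modules with highest vectors $1_\nu\in V$ and $1_\zeta\in Z$ of weights $\nu,\zeta\in\mathfrak h^*$. On each of them there is a unique Shapovalov form, that is, a symmetric bilinear form $\langle\cdot,\cdot\rangle$ such that $\langle xv,w\rangle=\langle v,\omega(x)w\rangle$ for all $x\in U_q(\mathfrak g)$, with value $1$ on the pair (highest vector, highest vector). The canonical form on $V\otimes Z$ is the product of the two: $\langle v\otimes z,w\otimes y\rangle=\langle v,w\rangle\langle z,y\rangle$. Let $(V\otimes Z)^+$ be the span of the singular vectors of $V\otimes Z$ (non-zero weight vectors killed by all $e_\alpha$). Let $I^-_Z\subset U_q(\mathfrak g_-)$ be the annihilator of $1_\zeta$, $I^+_Z=\sigma(I^-_Z)\subset U_q(\mathfrak g_+)$, $V^+_Z=\{v\in V: I^+_Zv=0\}$ and $V^\perp_Z=\omega(I^+_Z)V$.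 Then the following hold. 1. Every $u\in(V\otimes Z)^+$ has a unique leading coefficient, i.e. a vector $v\in V$ such that $u-v\otimes 1_\zeta$ is a sum of tensors $x\otimes z$ with $z$ of weight in $\zeta-(\mathbb Z_{\geq0}\Pi^+\setminus\{0\})$. Taking the leading coefficient is a linear isomorphism $(V\otimes Z)^+\to V^+_Z$. Denote the inverse by $\delta_l\colon V^+_Z\to(V\otimes Z)^+$. 2. Let ${}^+V_Z\subset V$ be any vector subspace complementary to $V^\perp_Z$. There is a unique linear map $\theta_{V,Z}\colon V^+_Z\to{}^+V_Z$ (the extremal twist operator) such that, whenever $v\in V^+_Z$ and $\delta_l(v)=\sum_i v_i\otimes f_i1_\zeta$ with $v_i\in V$, $f_i\in U_q(\mathfrak g_-)$, the vector $\theta_{V,Z}(v)$ is the projection of $\sum_i\gamma^{-1}(f_i)v_i$ to ${}^+V_Z$ along $V^\perp_Z$; and each $\delta_l(v)$ has such an expression. 3. The form $\langle\theta_{V,Z}(\cdot),\cdot\rangle$ on $V^+_Z$ is the pullback of the canonical form restricted to $(V\otimes Z)^+$ under $\delta_l$: $$\langle\delta_l(v),\delta_l(w)\rangle=\langle\theta_{V,Z}(v),w\rangle\qquad\text{for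 all } v,w\in V^+_Z .$$ -/

import Mathlib

open scoped TensorProduct

noncomputable section

/-! ### Quantum integers and quantum Serre polynomials -/

/-- The quantum integer `(p ^ n - p ^ (-n)) / (p - p ^ (-1))`. -/
def qInt (p : ℂ) (n : ℕ) : ℂ := (p ^ n - p⁻¹ ^ n) / (p - p⁻¹)

/-- The quantum factorial `[1]_p [2]_p ⋯ [n]_p`. -/
def qFact (p : ℂ) (n : ℕ) : ℂ := ∏ m ∈ Finset.range n, qInt p (m + 1)

/-- The quantum binomial coefficient (symmetric under `p ↦ p ^ (-1)`). -/
def qBinom (p : ℂ) (n r : ℕ) : ℂ := qFact p n / (qFact p r * qFact p (n - r))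

/-- The quantum Serre polynomial `∑ r, (-1) ^ r [n choose r]_p x ^ (n - r) y x ^ r`. -/
def qSerre {B : Type*} [Ring B] [Algebra ℂ B] (p : ℂ) (n : ℕ) (x y : B) : B :=
  ∑ r ∈ Finset.range (n + 1), ((-1) ^ r * qBinom p n r) • (x ^ (n - r) * y * x ^ r)

theorem map_qSerre {B C : Type*} [Ring B] [Algebra ℂ B] [Ring C] [Algebra ℂ C] (φ : B →ₐ[ℂ] C)
    (p : ℂ) (n : ℕ) (x y : B) : φ (qSerre p n x y) = qSerre p n (φ x) (φ y) := by
  simp [qSerre, map_sum]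

theorem qSerre_op {B : Type*} [Ring B] [Algebra ℂ B] (p : ℂ) (n : ℕ) (x y : B)
    (h : qSerre p n x y = 0) :
    qSerre p n (MulOpposite.op x) (MulOpposite.op y) = 0 := by
  have key : qSerre p n (MulOpposite.op x) (MulOpposite.op y)
      = MulOpposite.op ((-1 : ℂ) ^ n • qSerre p n x y) := by
    unfold qSerre
    rw [Finset.smul_sum, Finset.op_sum, ← Finset.sum_range_reflect]
    refine Finset.sum_congr rfl fun r hr => ?_
    have hr' : r ≤ n := Nat.lt_succ_iff.mp (Finset.mem_range.mp hr)
    have h1 : n + 1 - 1 - r = n - r := by omega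
    have h2 : n - (n - r) = r := by omega
    have h3 : qBinom p n (n - r) = qBinom p n r := by
      simp only [qBinom, h2]
      rw [mul_comm]
    have h4 : ((-1 : ℂ)) ^ (n - r) = (-1) ^ n * (-1) ^ r := by
      rw [← pow_add, show n + r = (n - r) + 2 * r by omega, pow_add, pow_mul]
      simp
    rw [h1, h2, h3, h4, smul_smul, MulOpposite.op_smul]
    simp only [MulOpposite.op_mul, MulOpposite.op_pow, mul_assoc]
  rw [key, h]
  simp

theorem mul_pow_of_qcomm {B : Type*} [Ring B] [Algebra ℂ B] {x m : B} {c : ℂ}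
    (h : m * x = c • (x * m)) (a : ℕ) :
    m ^ a * x = c ^ a • (x * m ^ a) := by
  induction a with
  | zero => simp
  | succ a ih =>
    rw [pow_succ, mul_assoc, h, mul_smul_comm, ← mul_assoc, ih, smul_mul_assoc, smul_smul,
      mul_assoc, ← pow_succ']

theorem pow_mul_pow_of_qcomm {B : Type*} [Ring B] [Algebra ℂ B] {x m : B} {c : ℂ}
    (h : m * x = c • (x * m)) (a b : ℕ) :
    m ^ a * x ^ b = c ^ (a * b) • (x ^ b * m ^ a) := by
  induction b with
  | zero => simp
  | succ b ih =>
    rw [pow_succ, ← mul_assoc, ih, smul_mul_assoc, mul_assoc, mul_pow_of_qcomm h, mul_smul_comm,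
      smul_smul, ← mul_assoc]
    congr 1
    ring

theorem mul_pow_eq_of_qcomm {B : Type*} [Ring B] [Algebra ℂ B] {x m : B} {c : ℂ}
    (h : m * x = c • (x * m)) (a : ℕ) :
    (x * m) ^ a = c ^ (a.choose 2) • (x ^ a * m ^ a) := by
  induction a with
  | zero => simp
  | succ a ih =>
    have e1 : (x ^ a * m ^ a) * (x * m) = c ^ a • (x ^ (a + 1) * m ^ (a + 1)) := by
      rw [mul_assoc, ← mul_assoc (m ^ a), mul_pow_of_qcomm h, smul_mul_assoc, mul_smul_comm,
        pow_succ x, pow_succ m]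
      simp only [mul_assoc]
    rw [pow_succ, ih, smul_mul_assoc, e1, smul_smul, ← pow_add, Nat.choose_succ_succ' a 1]
    simp [add_comm]

theorem choose_two_add (a r : ℕ) : (a + r).choose 2 = a.choose 2 + r.choose 2 + a * r := by
  induction r with
  | zero => simp
  | succ r ih =>
    rw [← add_assoc, Nat.choose_succ_succ' (a + r) 1, Nat.choose_succ_succ' r 1, ih]
    simp
    ring

/-- Quantum Serre relations survive multiplication of the generators by `q`-commuting elements. -/
theorem qSerre_twist {B : Type*} [Ring B] [Algebra ℂ B] (p : ℂ) (n : ℕ) (x y m l : B)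
    (c d s t : ℂ) (hmx : m * x = c • (x * m)) (hmy : m * y = d • (y * m))
    (hlx : l * x = d • (x * l)) (hml : m * l = l * m) (h : qSerre p n x y = 0) :
    qSerre p n (s • (x * m)) (t • (y * l)) = 0 := by
  have key : qSerre p n (s • (x * m)) (t • (y * l))
      = (s ^ n * t * c ^ (n.choose 2) * d ^ n) • (qSerre p n x y * (m ^ n * l)) := by
    unfold qSerre
    rw [Finset.sum_mul, Finset.smul_sum]
    refine Finset.sum_congr rfl fun r hr => ?_
    have hr' : r ≤ n := Nat.lt_succ_iff.mp (Finset.mem_range.mp hr)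
    obtain ⟨a, rfl⟩ := Nat.exists_eq_add_of_le' hr'
    have hch := choose_two_add a r
    have hlm : ∀ k : ℕ, l * m ^ k = m ^ k * l := fun k => (Commute.pow_right hml.symm k).eq
    have e1 : x ^ a * m ^ a * (y * l) * (x ^ r * m ^ r)
        = (d ^ (a + r) * c ^ (a * r)) • (x ^ a * y * x ^ r * (m ^ (a + r) * l)) := by
      calc x ^ a * m ^ a * (y * l) * (x ^ r * m ^ r)
          = x ^ a * (m ^ a * y) * (l * x ^ r) * m ^ r := by simp only [mul_assoc]
        _ = (d ^ a * d ^ r) • (x ^ a * y * (m ^ a * x ^ r) * (l * m ^ r)) := by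
            rw [mul_pow_of_qcomm hmy]
            have := pow_mul_pow_of_qcomm hlx 1 r
            rw [pow_one, one_mul] at this
            rw [this]
            simp only [mul_smul_comm, smul_mul_assoc, smul_smul, mul_assoc]
            rw [mul_comm (d ^ r)]
        _ = _ := by
            rw [pow_mul_pow_of_qcomm hmx, hlm]
            simp only [mul_smul_comm, smul_mul_assoc, smul_smul, mul_assoc, pow_add]
    rw [Nat.add_sub_cancel, smul_pow, smul_pow, mul_pow_eq_of_qcomm hmx, mul_pow_eq_of_qcomm hmx]
    simp only [mul_smul_comm, smul_mul_assoc, smul_smul]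
    rw [e1, smul_smul, hch]
    congr 1
    ring
  rw [key, h]
  simp

/-! ### The standard quantum group -/

/-- The input for the quantum group: `hbar = log q`, a symmetric bilinear form on the space `P`
of weights, the simple roots `α_i ∈ P` and the Cartan integers
`cartan i j = 2 (α_i, α_j) / (α_i, α_i)`. -/
structure QuantumDatum (I P : Type*) [AddCommGroup P] [Module ℂ P] where
  hbar : ℂ
  form : LinearMap.BilinForm ℂ P
  form_symm : ∀ x y, form x y = form y x
  root : I → P
  cartan : I → I → ℤ

/-- Generators `e_α`, `f_α`, `q ^ {h_α}`, `q ^ {-h_α}`. -/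
inductive QuantumGen (I : Type*) : Type _
  | e (i : I)
  | f (i : I)
  | k (i : I)
  | kinv (i : I)

namespace QuantumDatum

variable {I P : Type*} [AddCommGroup P] [Module ℂ P] (D : QuantumDatum I P)

/-- The deformation parameter. -/
def q : ℂ := Complex.exp D.hbar

/-- The power `q ^ z` for a complex exponent. -/
def qpow (z : ℂ) : ℂ := Complex.exp (D.hbar * z)

/-- A generator in the free algebra. -/
abbrev gen (g : QuantumGen I) : FreeAlgebra ℂ (QuantumGen I) := FreeAlgebra.ι ℂ g

open QuantumGen in
/-- Defining relations of the quantum group. -/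
inductive Rel : FreeAlgebra ℂ (QuantumGen I) → FreeAlgebra ℂ (QuantumGen I) → Prop
  | k_kinv (i : I) : Rel (gen (k i) * gen (kinv i)) 1
  | kinv_k (i : I) : Rel (gen (kinv i) * gen (k i)) 1
  | k_k (i j : I) : Rel (gen (k i) * gen (k j)) (gen (k j) * gen (k i))
  | k_e (i j : I) : Rel (gen (k i) * gen (e j))
      (D.qpow (D.form (D.root i) (D.root j)) • (gen (e j) * gen (k i)))
  | kinv_e (i j : I) : Rel (gen (kinv i) * gen (e j))
      (D.qpow (-D.form (D.root i) (D.root j)) • (gen (e j) * gen (kinv i)))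
  | k_f (i j : I) : Rel (gen (k i) * gen (f j))
      (D.qpow (-D.form (D.root i) (D.root j)) • (gen (f j) * gen (k i)))
  | kinv_f (i j : I) : Rel (gen (kinv i) * gen (f j))
      (D.qpow (D.form (D.root i) (D.root j)) • (gen (f j) * gen (kinv i)))
  | e_f_same (i : I) : Rel (gen (e i) * gen (f i) - gen (f i) * gen (e i))
      ((D.q - D.q⁻¹)⁻¹ • (gen (k i) - gen (kinv i)))
  | e_f_ne (i j : I) (h : i ≠ j) : Rel (gen (e i) * gen (f j) - gen (f j) * gen (e i)) 0
  | serre_e (i j : I) (h : i ≠ j) :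
      Rel (qSerre (D.qpow (D.form (D.root i) (D.root i) / 2)) (1 - D.cartan i j).toNat
        (gen (e i)) (gen (e j))) 0
  | serre_f (i j : I) (h : i ≠ j) :
      Rel (qSerre (D.qpow (D.form (D.root i) (D.root i) / 2)) (1 - D.cartan i j).toNat
        (gen (f i)) (gen (f j))) 0

/-- The quantum group `U_q(𝔤)`. -/
def Uq : Type _ := RingQuot D.Rel

instance : Ring D.Uq := inferInstanceAs (Ring (RingQuot D.Rel))
instance : Algebra ℂ D.Uq := inferInstanceAs (Algebra ℂ (RingQuot D.Rel))

/-- The projection from the free algebra. -/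
def proj : FreeAlgebra ℂ (QuantumGen I) →ₐ[ℂ] D.Uq := RingQuot.mkAlgHom ℂ D.Rel

/-- The generator `e_α`. -/
def e (i : I) : D.Uq := D.proj (gen (.e i))
/-- The generator `f_α`. -/
def f (i : I) : D.Uq := D.proj (gen (.f i))
/-- The generator `q ^ {h_α}`. -/
def k (i : I) : D.Uq := D.proj (gen (.k i))
/-- The generator `q ^ {-h_α}`. -/
def kinv (i : I) : D.Uq := D.proj (gen (.kinv i))

theorem proj_rel {x y : FreeAlgebra ℂ (QuantumGen I)} (h : D.Rel x y) : D.proj x = D.proj y :=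
  RingQuot.mkAlgHom_rel ℂ h

theorem k_mul_kinv (i : I) : D.k i * D.kinv i = 1 := by
  simpa [k, kinv] using D.proj_rel (.k_kinv i)

theorem kinv_mul_k (i : I) : D.kinv i * D.k i = 1 := by
  simpa [k, kinv] using D.proj_rel (.kinv_k i)

theorem k_mul_k (i j : I) : D.k i * D.k j = D.k j * D.k i := by
  simpa [k] using D.proj_rel (.k_k i j)

theorem k_mul_e (i j : I) :
    D.k i * D.e j = D.qpow (D.form (D.root i) (D.root j)) • (D.e j * D.k i) := by
  simpa [k, e] using D.proj_rel (.k_e i j)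

theorem kinv_mul_e (i j : I) :
    D.kinv i * D.e j = D.qpow (-D.form (D.root i) (D.root j)) • (D.e j * D.kinv i) := by
  simpa [kinv, e] using D.proj_rel (.kinv_e i j)

theorem k_mul_f (i j : I) :
    D.k i * D.f j = D.qpow (-D.form (D.root i) (D.root j)) • (D.f j * D.k i) := by
  simpa [k, f] using D.proj_rel (.k_f i j)

theorem kinv_mul_f (i j : I) :
    D.kinv i * D.f j = D.qpow (D.form (D.root i) (D.root j)) • (D.f j * D.kinv i) := by
  simpa [kinv, f] using D.proj_rel (.kinv_f i j)

theorem e_mul_f_same (i : I) :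
    D.e i * D.f i - D.f i * D.e i = (D.q - D.q⁻¹)⁻¹ • (D.k i - D.kinv i) := by
  simpa [k, kinv, e, f] using D.proj_rel (.e_f_same i)

theorem e_mul_f_ne {i j : I} (h : i ≠ j) : D.e i * D.f j - D.f j * D.e i = 0 := by
  simpa [e, f] using D.proj_rel (.e_f_ne i j h)

theorem serre_e {i j : I} (h : i ≠ j) :
    qSerre (D.qpow (D.form (D.root i) (D.root i) / 2)) (1 - D.cartan i j).toNat
      (D.e i) (D.e j) = 0 := by
  simpa [map_qSerre, e] using D.proj_rel (.serre_e i j h)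

theorem serre_f {i j : I} (h : i ≠ j) :
    qSerre (D.qpow (D.form (D.root i) (D.root i) / 2)) (1 - D.cartan i j).toNat
      (D.f i) (D.f j) = 0 := by
  simpa [map_qSerre, f] using D.proj_rel (.serre_f i j h)

theorem qpow_mul_neg (z : ℂ) : D.qpow z * D.qpow (-z) = 1 := by
  simp [qpow, ← Complex.exp_add]

theorem qpow_neg_mul (z : ℂ) : D.qpow (-z) * D.qpow z = 1 := by
  simp [qpow, ← Complex.exp_add]

theorem e_mul_kinv (i j : I) :
    D.e j * D.kinv i = D.qpow (D.form (D.root i) (D.root j)) • (D.kinv i * D.e j) := by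
  rw [kinv_mul_e, smul_smul, qpow_mul_neg, one_smul]

theorem e_mul_k (i j : I) :
    D.e j * D.k i = D.qpow (-D.form (D.root i) (D.root j)) • (D.k i * D.e j) := by
  rw [k_mul_e, smul_smul, qpow_neg_mul, one_smul]

theorem f_mul_k (i j : I) :
    D.f j * D.k i = D.qpow (D.form (D.root i) (D.root j)) • (D.k i * D.f j) := by
  rw [k_mul_f, smul_smul, qpow_mul_neg, one_smul]

theorem f_mul_kinv (i j : I) :
    D.f j * D.kinv i = D.qpow (-D.form (D.root i) (D.root j)) • (D.kinv i * D.f j) := by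
  rw [kinv_mul_f, smul_smul, qpow_neg_mul, one_smul]

theorem kinv_mul_k_comm (i j : I) : D.kinv i * D.k j = D.k j * D.kinv i := by
  calc D.kinv i * D.k j = D.kinv i * (D.k j * D.k i) * D.kinv i := by
        rw [mul_assoc, mul_assoc, k_mul_kinv, mul_one]
    _ = D.k j * D.kinv i := by
        rw [← k_mul_k, ← mul_assoc (D.kinv i), kinv_mul_k, one_mul]

theorem kinv_mul_kinv (i j : I) : D.kinv i * D.kinv j = D.kinv j * D.kinv i := by
  calc D.kinv i * D.kinv j = D.kinv j * (D.k j * D.kinv i) * D.kinv j := by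
        rw [← mul_assoc, kinv_mul_k, one_mul]
    _ = D.kinv j * D.kinv i := by
        rw [← kinv_mul_k_comm, mul_assoc, mul_assoc, k_mul_kinv, mul_one]

/-! ### The maps `σ`, `γ⁻¹` and `ω` -/

/-- Values of `σ` on the generators. -/
def sigmaGen : QuantumGen I → D.Uq
  | .e i => D.f i
  | .f i => D.e i
  | .k i => D.kinv i
  | .kinv i => D.k i

/-- The algebra automorphism `σ`: `e_α ↦ f_α`, `f_α ↦ e_α`, `q ^ {h_α} ↦ q ^ {-h_α}`. -/
def sigma : D.Uq →ₐ[ℂ] D.Uq :=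
  RingQuot.liftAlgHom ℂ ⟨FreeAlgebra.lift ℂ D.sigmaGen, by
    intro x y h
    cases h with
    | k_kinv i => simp [sigmaGen, kinv_mul_k]
    | kinv_k i => simp [sigmaGen, k_mul_kinv]
    | k_k i j => simpa [sigmaGen] using D.kinv_mul_kinv i j
    | k_e i j => simpa [sigmaGen] using D.kinv_mul_f i j
    | kinv_e i j => simpa [sigmaGen] using D.k_mul_f i j
    | k_f i j => simpa [sigmaGen] using D.kinv_mul_e i j
    | kinv_f i j => simpa [sigmaGen] using D.k_mul_e i j
    | e_f_same i =>
      simp only [sigmaGen, map_sub, map_mul, map_smul, FreeAlgebra.lift_ι_apply]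
      rw [← neg_sub, e_mul_f_same, ← smul_neg, neg_sub]
    | e_f_ne i j h =>
      simp only [sigmaGen, map_sub, map_mul, map_zero, FreeAlgebra.lift_ι_apply]
      rw [← neg_sub, D.e_mul_f_ne h.symm, neg_zero]
    | serre_e i j h => simpa [sigmaGen, map_qSerre] using D.serre_f h
    | serre_f i j h => simpa [sigmaGen, map_qSerre] using D.serre_e h⟩

/-- Values of the inverse antipode on the generators. -/
def antipodeInvGen : QuantumGen I → D.Uqᵐᵒᵖ
  | .e i => MulOpposite.op (-(D.kinv i * D.e i))
  | .f i => MulOpposite.op (-(D.f i * D.k i))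
  | .k i => MulOpposite.op (D.kinv i)
  | .kinv i => MulOpposite.op (D.k i)

/-- The inverse antipode `γ⁻¹` as a homomorphism to the opposite algebra:
`e_α ↦ -q ^ {-h_α} e_α`, `f_α ↦ -f_α q ^ {h_α}`, `q ^ {h_α} ↦ q ^ {-h_α}`. It is the inverse of
the antipode `γ`: `e_α ↦ -e_α q ^ {-h_α}`, `f_α ↦ -q ^ {h_α} f_α`, `q ^ {h_α} ↦ q ^ {-h_α}`. -/
def antipodeInvOp : D.Uq →ₐ[ℂ] D.Uqᵐᵒᵖ :=
  RingQuot.liftAlgHom ℂ ⟨FreeAlgebra.lift ℂ D.antipodeInvGen, by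
    intro x y h
    cases h with
    | k_kinv i => simp [antipodeInvGen, ← MulOpposite.op_mul, k_mul_kinv]
    | kinv_k i => simp [antipodeInvGen, ← MulOpposite.op_mul, kinv_mul_k]
    | k_k i j => simp [antipodeInvGen, ← MulOpposite.op_mul, D.kinv_mul_kinv i j]
    | k_e i j =>
      simp only [antipodeInvGen, map_mul, map_smul, FreeAlgebra.lift_ι_apply,
        ← MulOpposite.op_mul, ← MulOpposite.op_smul, neg_mul, mul_neg, smul_neg]
      rw [mul_assoc, e_mul_kinv, mul_smul_comm, ← mul_assoc, D.kinv_mul_kinv j i, mul_assoc]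
    | kinv_e i j =>
      simp only [antipodeInvGen, map_mul, map_smul, FreeAlgebra.lift_ι_apply,
        ← MulOpposite.op_mul, ← MulOpposite.op_smul, neg_mul, mul_neg, smul_neg]
      rw [mul_assoc, e_mul_k, mul_smul_comm, ← mul_assoc, D.kinv_mul_k_comm j i, mul_assoc]
    | k_f i j =>
      simp only [antipodeInvGen, map_mul, map_smul, FreeAlgebra.lift_ι_apply,
        ← MulOpposite.op_mul, ← MulOpposite.op_smul, neg_mul, mul_neg, smul_neg]
      rw [mul_assoc, ← D.kinv_mul_k_comm i j, ← mul_assoc, f_mul_kinv, smul_mul_assoc, mul_assoc]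
    | kinv_f i j =>
      simp only [antipodeInvGen, map_mul, map_smul, FreeAlgebra.lift_ι_apply,
        ← MulOpposite.op_mul, ← MulOpposite.op_smul, neg_mul, mul_neg, smul_neg]
      rw [mul_assoc, ← D.k_mul_k i j, ← mul_assoc, f_mul_k, smul_mul_assoc, mul_assoc]
    | e_f_same i =>
      simp only [antipodeInvGen, map_sub, map_mul, map_smul, FreeAlgebra.lift_ι_apply,
        ← MulOpposite.op_mul, ← MulOpposite.op_smul, ← MulOpposite.op_sub, neg_mul, mul_neg,
        neg_neg]
      congr 1
      have h1 : D.f i * D.k i * (D.kinv i * D.e i) = D.f i * D.e i := by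
        rw [mul_assoc, ← mul_assoc (D.k i), k_mul_kinv, one_mul]
      have h2 : D.kinv i * D.e i * (D.f i * D.k i) = D.e i * D.f i := by
        rw [mul_assoc, f_mul_k, mul_smul_comm, mul_smul_comm, ← mul_assoc (D.e i), e_mul_k,
          smul_mul_assoc, mul_smul_comm, smul_smul, qpow_mul_neg, one_smul, ← mul_assoc,
          ← mul_assoc, kinv_mul_k, one_mul]
      rw [h1, h2, ← neg_sub, e_mul_f_same, ← smul_neg, neg_sub]
    | e_f_ne i j h =>
      simp only [antipodeInvGen, map_sub, map_mul, map_zero, FreeAlgebra.lift_ι_apply,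
        ← MulOpposite.op_mul, ← MulOpposite.op_sub, neg_mul, mul_neg, neg_neg]
      have h1 : D.f j * D.k j * (D.kinv i * D.e i)
          = D.qpow (-D.form (D.root i) (D.root i)) • D.qpow (D.form (D.root j) (D.root i)) •
            (D.f j * D.e i * (D.kinv i * D.k j)) := by
        rw [kinv_mul_e, mul_smul_comm, mul_assoc, ← mul_assoc (D.k j), k_mul_e]
        simp only [mul_smul_comm, smul_mul_assoc, mul_assoc, D.kinv_mul_k_comm]
      have h2 : D.kinv i * D.e i * (D.f j * D.k j)
          = D.qpow (-D.form (D.root i) (D.root i)) • D.qpow (D.form (D.root i) (D.root j)) •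
            (D.e i * D.f j * (D.kinv i * D.k j)) := by
        rw [kinv_mul_e, smul_mul_assoc, mul_assoc, ← mul_assoc (D.kinv i), kinv_mul_f]
        simp only [mul_smul_comm, smul_mul_assoc, mul_assoc]
      rw [h1, h2, D.form_symm (D.root j) (D.root i), ← smul_sub, ← smul_sub, ← sub_mul, ← neg_sub,
        D.e_mul_f_ne h]
      simp
    | serre_e i j h =>
      rw [map_qSerre, map_zero]
      have := qSerre_twist _ _ (MulOpposite.op (D.e i)) (MulOpposite.op (D.e j))
        (MulOpposite.op (D.kinv i)) (MulOpposite.op (D.kinv j))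
        (D.qpow (D.form (D.root i) (D.root i))) (D.qpow (D.form (D.root i) (D.root j))) (-1) (-1)
        (by simp only [← MulOpposite.op_mul, ← MulOpposite.op_smul, ← e_mul_kinv])
        (by simp only [← MulOpposite.op_mul, ← MulOpposite.op_smul, ← e_mul_kinv])
        (by simp only [← MulOpposite.op_mul, ← MulOpposite.op_smul,
              D.form_symm (D.root i) (D.root j), ← e_mul_kinv])
        (by simp only [← MulOpposite.op_mul, D.kinv_mul_kinv i j])
        (qSerre_op _ _ _ _ (D.serre_e h))
      simpa [antipodeInvGen] using this
    | serre_f i j h =>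
      rw [map_qSerre, map_zero]
      have := qSerre_twist _ _ (MulOpposite.op (D.f i)) (MulOpposite.op (D.f j))
        (MulOpposite.op (D.k i)) (MulOpposite.op (D.k j))
        (D.qpow (D.form (D.root i) (D.root i))) (D.qpow (D.form (D.root i) (D.root j)))
        (-D.qpow (D.form (D.root i) (D.root i))) (-D.qpow (D.form (D.root j) (D.root j)))
        (by simp only [← MulOpposite.op_mul, ← MulOpposite.op_smul, ← f_mul_k])
        (by simp only [← MulOpposite.op_mul, ← MulOpposite.op_smul, ← f_mul_k])
        (by simp only [← MulOpposite.op_mul, ← MulOpposite.op_smul,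
              D.form_symm (D.root i) (D.root j), ← f_mul_k])
        (by simp only [← MulOpposite.op_mul, D.k_mul_k i j])
        (qSerre_op _ _ _ _ (D.serre_f h))
      simpa [antipodeInvGen, f_mul_k] using this⟩

/-- The inverse antipode `γ⁻¹`, a linear map reversing products. -/
def antipodeInv : D.Uq →ₗ[ℂ] D.Uq :=
  (MulOpposite.opLinearEquiv ℂ).symm.toLinearMap ∘ₗ D.antipodeInvOp.toLinearMap

/-- The anti-automorphism `ω = γ⁻¹ ∘ σ`. -/
def omega : D.Uq →ₗ[ℂ] D.Uq := D.antipodeInv ∘ₗ D.sigma.toLinearMap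

theorem sigma_e (i : I) : D.sigma (D.e i) = D.f i := by
  change RingQuot.liftAlgHom ℂ _ (RingQuot.mkAlgHom ℂ D.Rel _) = _
  simp [sigmaGen]

theorem sigma_f (i : I) : D.sigma (D.f i) = D.e i := by
  change RingQuot.liftAlgHom ℂ _ (RingQuot.mkAlgHom ℂ D.Rel _) = _
  simp [sigmaGen]

theorem sigma_k (i : I) : D.sigma (D.k i) = D.kinv i := by
  change RingQuot.liftAlgHom ℂ _ (RingQuot.mkAlgHom ℂ D.Rel _) = _
  simp [sigmaGen]

theorem antipodeInv_mul (x y : D.Uq) :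
    D.antipodeInv (x * y) = D.antipodeInv y * D.antipodeInv x := by
  simp [antipodeInv]

theorem antipodeInv_e (i : I) : D.antipodeInv (D.e i) = -(D.kinv i * D.e i) := by
  change MulOpposite.unop (RingQuot.liftAlgHom ℂ _ (RingQuot.mkAlgHom ℂ D.Rel _)) = _
  simp [antipodeInvGen]

theorem antipodeInv_f (i : I) : D.antipodeInv (D.f i) = -(D.f i * D.k i) := by
  change MulOpposite.unop (RingQuot.liftAlgHom ℂ _ (RingQuot.mkAlgHom ℂ D.Rel _)) = _
  simp [antipodeInvGen]

theorem antipodeInv_k (i : I) : D.antipodeInv (D.k i) = D.kinv i := by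
  change MulOpposite.unop (RingQuot.liftAlgHom ℂ _ (RingQuot.mkAlgHom ℂ D.Rel _)) = _
  simp [antipodeInvGen]

theorem antipodeInv_kinv (i : I) : D.antipodeInv (D.kinv i) = D.k i := by
  change MulOpposite.unop (RingQuot.liftAlgHom ℂ _ (RingQuot.mkAlgHom ℂ D.Rel _)) = _
  simp [antipodeInvGen]

/-- `γ⁻¹ (γ (e_α)) = e_α`. -/
theorem antipodeInv_antipode_e (i : I) : D.antipodeInv (-(D.e i * D.kinv i)) = D.e i := by
  rw [map_neg, antipodeInv_mul, antipodeInv_e, antipodeInv_kinv, mul_neg, neg_neg, ← mul_assoc,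
    k_mul_kinv, one_mul]

/-- `γ⁻¹ (γ (f_α)) = f_α`. -/
theorem antipodeInv_antipode_f (i : I) : D.antipodeInv (-(D.k i * D.f i)) = D.f i := by
  rw [map_neg, antipodeInv_mul, antipodeInv_f, antipodeInv_k, neg_mul, neg_neg, mul_assoc,
    k_mul_kinv, mul_one]

/-! ### Modules -/

section OneModule

variable (V : Type*) [AddCommGroup V] [Module ℂ V] [Module D.Uq V]

/-- The weight space `V[μ]`. -/
def weightSpace [IsScalarTower ℂ D.Uq V] (μ : P) : Submodule ℂ V where
  carrier := {v | ∀ i, D.k i • v = D.qpow (D.form (D.root i) μ) • v}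
  add_mem' hx hy i := by rw [smul_add, smul_add, hx i, hy i]
  zero_mem' i := by simp
  smul_mem' c x hx i := by rw [smul_algebra_smul_comm, hx i, smul_comm]

variable {V}

/-- `V` is a highest weight module with highest vector `v₀` of weight `ν`. -/
structure IsHighestWeight [IsScalarTower ℂ D.Uq V] (v₀ : V) (ν : P) : Prop where
  ne_zero : v₀ ≠ 0
  mem_weightSpace : v₀ ∈ D.weightSpace V ν
  e_smul : ∀ i, D.e i • v₀ = 0
  cyclic : Submodule.span D.Uq {v₀} = ⊤

/-- The Shapovalov form of a highest weight module with highest vector `v₀`: the symmetric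
bilinear form contravariant with respect to `ω` and normalized to `1` on `v₀`. -/
structure IsShapovalovForm (v₀ : V) (B : LinearMap.BilinForm ℂ V) : Prop where
  symm : ∀ v w, B v w = B w v
  contravariant : ∀ (x : D.Uq) (v w : V), B (x • v) w = B v (D.omega x • w)
  normalized : B v₀ v₀ = 1

end OneModule

/-- The subalgebra `U_q(𝔤_-)` generated by the `f_α`. -/
def UqMinus : Subalgebra ℂ D.Uq := Algebra.adjoin ℂ (Set.range D.f)

section TwoModules

variable (V : Type*) {Z : Type*} [AddCommGroup V] [Module ℂ V] [Module D.Uq V]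
  [IsScalarTower ℂ D.Uq V] [AddCommGroup Z] [Module ℂ Z] [Module D.Uq Z] [IsScalarTower ℂ D.Uq Z]

/-- `I⁻_Z`, the annihilator of the highest vector `z₀` of `Z` in `U_q(𝔤_-)`. -/
def annMinus (z₀ : Z) : Submodule ℂ D.Uq where
  carrier := {x | x ∈ D.UqMinus ∧ x • z₀ = 0}
  add_mem' hx hy := ⟨add_mem hx.1 hy.1, by rw [add_smul, hx.2, hy.2, add_zero]⟩
  zero_mem' := ⟨zero_mem _, zero_smul _ _⟩
  smul_mem' c _ hx := ⟨D.UqMinus.smul_mem hx.1 c, by rw [smul_assoc, hx.2, smul_zero]⟩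

/-- `I⁺_Z = σ(I⁻_Z)`. -/
def annPlus (z₀ : Z) : Submodule ℂ D.Uq := (D.annMinus z₀).map D.sigma.toLinearMap

/-- The extremal subspace `V⁺_Z`, the kernel of `I⁺_Z` in `V`. -/
def extremalSpace (z₀ : Z) : Submodule ℂ V where
  carrier := {v | ∀ x ∈ D.annPlus z₀, x • v = 0}
  add_mem' hv hw x hx := by rw [smul_add, hv x hx, hw x hx, add_zero]
  zero_mem' _ _ := smul_zero _
  smul_mem' c v hv x hx := by rw [smul_algebra_smul_comm, hv x hx, smul_zero]

/-- `V^⊥_Z = ω(I⁺_Z) V`. -/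
def extremalPerp (z₀ : Z) : Submodule ℂ V :=
  Submodule.span ℂ {w | ∃ x ∈ D.annPlus z₀, ∃ v : V, w = D.omega x • v}

/-- Comultiplication on the generators. -/
def comulGen : QuantumGen I → D.Uq ⊗[ℂ] D.Uq
  | .e i => D.e i ⊗ₜ D.k i + 1 ⊗ₜ D.e i
  | .f i => D.f i ⊗ₜ 1 + D.kinv i ⊗ₜ D.f i
  | .k i => D.k i ⊗ₜ D.k i
  | .kinv i => D.kinv i ⊗ₜ D.kinv i

variable (Z)

/-- The action of `U_q(𝔤) ⊗ U_q(𝔤)` on `V ⊗ Z`. -/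
def tensorAction : D.Uq ⊗[ℂ] D.Uq →ₐ[ℂ] Module.End ℂ (V ⊗[ℂ] Z) :=
  (Module.endTensorEndAlgHom (R := ℂ) (S := ℂ) (A := ℂ) (M := V) (N := Z)).comp
    (Algebra.TensorProduct.map (Algebra.lsmul ℂ ℂ V) (Algebra.lsmul ℂ ℂ Z))

/-- The action of the generators of `U_q(𝔤)` on the tensor product of modules. -/
def genAction (g : QuantumGen I) : Module.End ℂ (V ⊗[ℂ] Z) := D.tensorAction V Z (D.comulGen g)

/-- A singular vector of `V ⊗ Z`: a non-zero weight vector killed by all `e_α`. -/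
def IsSingularVector (u : V ⊗[ℂ] Z) : Prop :=
  u ≠ 0 ∧ (∃ μ : P, ∀ i, D.genAction V Z (.k i) u = D.qpow (D.form (D.root i) μ) • u) ∧
    ∀ i, D.genAction V Z (.e i) u = 0

/-- `(V ⊗ Z)⁺`, the span of the singular vectors. -/
def singularSpace : Submodule ℂ (V ⊗[ℂ] Z) := Submodule.span ℂ {u | D.IsSingularVector V Z u}

variable {V Z}

/-- `v` is the leading coefficient of `u ∈ V ⊗ Z`, that is, the coefficient at the highest vector
`z₀` of `Z`, of weight `ζ`: the difference `u - v ⊗ z₀` is a sum of tensors `x ⊗ z` with `z` of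
weight `ζ - ∑ n_α α`, where the `n_α` are non-negative integers and not all zero. -/
def IsLeadingCoeff (z₀ : Z) (ζ : P) (u : V ⊗[ℂ] Z) (v : V) : Prop :=
  u - v ⊗ₜ z₀ ∈ Submodule.span ℂ {t : V ⊗[ℂ] Z | ∃ (n : I →₀ ℕ) (x : V) (z : Z), n ≠ 0 ∧
    z ∈ D.weightSpace Z (ζ - n.sum fun i a => a • D.root i) ∧ t = x ⊗ₜ z}

/-- The map `V ⊗ U_q(𝔤_-) → V ⊗ Z`, `x ⊗ f ↦ x ⊗ f z₀`. A preimage of `u` is a lift of the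
`Z`-coefficients of `u` to `U_q(𝔤_-)`. -/
def evalLift (z₀ : Z) : V ⊗[ℂ] D.UqMinus →ₗ[ℂ] V ⊗[ℂ] Z :=
  LinearMap.lTensor V ((Algebra.lsmul ℂ ℂ Z).toLinearMap.flip z₀ ∘ₗ D.UqMinus.val.toLinearMap)

/-- The map `V ⊗ U_q(𝔤_-) → V`, `x ⊗ f ↦ γ⁻¹(f) x`. -/
def twistLift : V ⊗[ℂ] D.UqMinus →ₗ[ℂ] V :=
  TensorProduct.lift
    (((Algebra.lsmul ℂ ℂ V).toLinearMap ∘ₗ D.antipodeInv ∘ₗ D.UqMinus.val.toLinearMap).flip)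

/-- `δ` is the isomorphism `δ_l : V⁺_Z → (V ⊗ Z)⁺`, the inverse of the map that takes a vector
of `(V ⊗ Z)⁺` to its leading coefficient. -/
def IsDeltaL (z₀ : Z) (ζ : P) (δ : D.extremalSpace V z₀ ≃ₗ[ℂ] D.singularSpace V Z) : Prop :=
  ∀ (u : D.singularSpace V Z) (v : V),
    D.IsLeadingCoeff z₀ ζ (u : V ⊗[ℂ] Z) v ↔ (δ.symm u : V) = v

/-- `θ` is the extremal twist operator with values in a complement `C` of `V^⊥_Z`: for every lift
`∑ x_i ⊗ f_i ∈ V ⊗ U_q(𝔤_-)` of `δ v`, the vector `θ v` is the projection of `∑ γ⁻¹(f_i) x_i` to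
`C` along `V^⊥_Z`; and every `δ v` has a lift. -/
structure IsExtremalTwist (z₀ : Z) (δ : D.extremalSpace V z₀ ≃ₗ[ℂ] D.singularSpace V Z)
    {C : Submodule ℂ V} (hC : IsCompl C (D.extremalPerp V z₀))
    (θ : D.extremalSpace V z₀ →ₗ[ℂ] C) : Prop where
  exists_lift : ∀ v, ∃ t : V ⊗[ℂ] D.UqMinus, D.evalLift z₀ t = (δ v : V ⊗[ℂ] Z)
  eq_of_lift : ∀ v (t : V ⊗[ℂ] D.UqMinus), D.evalLift z₀ t = (δ v : V ⊗[ℂ] Z) →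
    θ v = Submodule.projectionOnto C (D.extremalPerp V z₀) hC (D.twistLift t)

/-- The canonical contravariant form on `V ⊗ Z`, the product of the Shapovalov forms:
`⟨v ⊗ z, w ⊗ y⟩ = ⟨v, w⟩ ⟨z, y⟩`. -/
def canonicalForm (BV : LinearMap.BilinForm ℂ V) (BZ : LinearMap.BilinForm ℂ Z) :
    LinearMap.BilinForm ℂ (V ⊗[ℂ] Z) := LinearMap.BilinForm.tmul BV BZ

end TwoModules

theorem canonicalForm_tmul {V Z : Type*} [AddCommGroup V] [Module ℂ V] [AddCommGroup Z]
    [Module ℂ Z] (BV : LinearMap.BilinForm ℂ V) (BZ : LinearMap.BilinForm ℂ Z) (v w : V)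
    (z y : Z) : canonicalForm BV BZ (v ⊗ₜ z) (w ⊗ₜ y) = BV v w * BZ z y := by
  simp [canonicalForm, mul_comm]

end QuantumDatum

/-! ### The datum of a semisimple Lie algebra -/

section Lie

variable {L : Type*} [LieRing L] [LieAlgebra ℂ L] [FiniteDimensional ℂ L]
  [LieAlgebra.IsSemisimple ℂ L] {H : LieSubalgebra ℂ L} [H.IsCartanSubalgebra]

/-- The bilinear form on `𝔥*` transferred from the form `κ • (Killing form)` on `𝔥`. -/
def dualForm (H : LieSubalgebra ℂ L) [H.IsCartanSubalgebra] (κ : ℂ) :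
    LinearMap.BilinForm ℂ (Module.Dual ℂ H) :=
  κ⁻¹ • (LinearMap.id.compl₁₂ LinearMap.id
    (LieAlgebra.IsKilling.cartanEquivDual H).symm.toLinearMap :
      LinearMap.BilinForm ℂ (Module.Dual ℂ H))

theorem dualForm_apply (κ : ℂ) (x y : Module.Dual ℂ H) :
    dualForm H κ x y = κ⁻¹ * x ((LieAlgebra.IsKilling.cartanEquivDual H).symm y) := rfl

theorem dualForm_symm (κ : ℂ) (x y : Module.Dual ℂ H) :
    dualForm H κ x y = dualForm H κ y x := by
  have key : ∀ a b : Module.Dual ℂ H, a ((LieAlgebra.IsKilling.cartanEquivDual H).symm b)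
      = LieModule.traceForm ℂ H L ((LieAlgebra.IsKilling.cartanEquivDual H).symm a)
        ((LieAlgebra.IsKilling.cartanEquivDual H).symm b) := fun a b => by
    conv_lhs => rw [← (LieAlgebra.IsKilling.cartanEquivDual H).apply_symm_apply a]
    rfl
  rw [dualForm_apply, dualForm_apply, key x y, key y x, LieModule.traceForm_comm]

/-- The datum of the quantum group of a complex semisimple Lie algebra with Cartan subalgebra `H`,
base `b` of the root system, `q = exp ħ`, and the form `κ • (Killing form)` on `𝔥`. -/
def quantumDatum (b : (LieAlgebra.IsKilling.rootSystem H).Base) (κ ħ : ℂ) :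
    QuantumDatum b.support (Module.Dual ℂ H) where
  hbar := ħ
  form := dualForm H κ
  form_symm := dualForm_symm κ
  root i := (LieAlgebra.IsKilling.rootSystem H).root i
  cartan i j := b.cartanMatrix j i

end Lie

end

noncomputable section

namespace QuantumDatum

variable {I P : Type*} [AddCommGroup P] [Module ℂ P] (D : QuantumDatum I P)

/-! ### The involutions `σ` and `ω` -/

/-! Contracting the second factor of `V ⊗ Z` with the Shapovalov form of `Z` turns a tensor `u` into
a linear map `ψ_u : Z → V`. This loses nothing, since the form is non-degenerate on the irreducible
module `Z`. By the formulas for `Δ(e_α)` and `ω(e_α)`, `u` is killed by every `e_α` exactly when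
`ψ_u(f_α y) = e_α ψ_u(y)`, and then `ψ_u(x y) = σ(x) ψ_u(y)` for `x ∈ U_q(𝔤_-)`
(`genAction_e_eq_zero_iff`). Such a map is determined by `v = ψ_u(1_ζ)`, which is the leading
coefficient of `u` (`isLeadingCoeff_iff`), and `ψ(x 1_ζ) = σ(x) v` is consistent exactly when `v ∈
V⁺_Z`. That this `ψ` comes from a tensor is a finiteness statement (`exists_contract_eq`): long
products of the `e_α` kill `v`, so `ψ` vanishes on long products of the `f_α`, and the form is
non-degenerate on the finite-dimensional span of the shorter ones.

The twist enters through `ω ∘ σ = γ⁻¹`: for singular `u`, `⟨v ⊗ x 1_ζ, u⟩ = ⟨v, ψ_u(x 1_ζ)⟩ = ⟨v,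
σ(x) ψ_u(1_ζ)⟩ = ⟨γ⁻¹(x) v, ψ_u(1_ζ)⟩` (`canonicalForm_evalLift`). Projecting along `V^⊥_Z` changes
nothing, because `V^⊥_Z` is orthogonal to `V⁺_Z`. The same identity sends the ambiguity of a lift,
`V ⊗ I⁻_Z`, into `V^⊥_Z`, so `θ` is well defined.

The forms themselves come from the spanning half of the triangular decomposition. It shows that a
highest weight module is spanned by products of the `f_α` applied to the highest vector. The root of
unity hypothesis separates the highest weight from all lower ones, which gives a functional `φ`
equal to `1` on the highest vector and `0` on the images of the `f_α`; the form is `⟨x 1_ζ, y 1_ζ⟩ =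
φ(ω(x) y 1_ζ)`. -/

theorem sigma_kinv (i : I) : D.sigma (D.kinv i) = D.k i := by
  change RingQuot.liftAlgHom ℂ _ (RingQuot.mkAlgHom ℂ D.Rel _) = _
  simp [sigmaGen]

theorem adjoin_generators_eq_top :
    Algebra.adjoin ℂ (Set.range D.e ∪ Set.range D.f ∪ Set.range D.k ∪ Set.range D.kinv)
      = (⊤ : Subalgebra ℂ D.Uq) := by
  have h1 : (⊤ : Subalgebra ℂ D.Uq)
      = (Algebra.adjoin ℂ (Set.range (FreeAlgebra.ι ℂ (X := QuantumGen I)))).map D.proj := by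
    rw [FreeAlgebra.adjoin_range_ι, Algebra.map_top, eq_comm, AlgHom.range_eq_top]
    exact RingQuot.mkAlgHom_surjective ℂ D.Rel
  refine top_le_iff.mp ?_
  rw [h1, AlgHom.map_adjoin]
  refine Algebra.adjoin_mono ?_
  rintro _ ⟨_, ⟨g, rfl⟩, rfl⟩
  cases g with
  | e i => exact Or.inl (Or.inl (Or.inl ⟨i, rfl⟩))
  | f i => exact Or.inl (Or.inl (Or.inr ⟨i, rfl⟩))
  | k i => exact Or.inl (Or.inr ⟨i, rfl⟩)
  | kinv i => exact Or.inr ⟨i, rfl⟩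

/-- An induction principle over products of generators. -/
theorem Uq_induction {p : D.Uq → Prop} (he : ∀ i, p (D.e i)) (hf : ∀ i, p (D.f i))
    (hk : ∀ i, p (D.k i)) (hkinv : ∀ i, p (D.kinv i)) (hc : ∀ c, p (algebraMap ℂ D.Uq c))
    (hadd : ∀ x y, p x → p y → p (x + y)) (hmul : ∀ x y, p x → p y → p (x * y)) (x : D.Uq) :
    p x := by
  have hx : x ∈ Algebra.adjoin ℂ
      (Set.range D.e ∪ Set.range D.f ∪ Set.range D.k ∪ Set.range D.kinv) := by
    rw [adjoin_generators_eq_top]; trivial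
  induction hx using Algebra.adjoin_induction with
  | mem x hx =>
    obtain ((⟨i, rfl⟩ | ⟨i, rfl⟩) | ⟨i, rfl⟩) | ⟨i, rfl⟩ := hx
    exacts [he i, hf i, hk i, hkinv i]
  | algebraMap c => exact hc c
  | add x y _ _ hx hy => exact hadd x y hx hy
  | mul x y _ _ hx hy => exact hmul x y hx hy

/-- A linear subspace of a module that is stable under the generators is stable under the
quantum group. -/
theorem smul_mem_of_generators {V : Type*} [AddCommGroup V] [Module ℂ V] [Module D.Uq V]
    [IsScalarTower ℂ D.Uq V] (S : Submodule ℂ V) (he : ∀ i, ∀ v ∈ S, D.e i • v ∈ S)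
    (hf : ∀ i, ∀ v ∈ S, D.f i • v ∈ S) (hk : ∀ i, ∀ v ∈ S, D.k i • v ∈ S)
    (hkinv : ∀ i, ∀ v ∈ S, D.kinv i • v ∈ S) (x : D.Uq) : ∀ v ∈ S, x • v ∈ S := by
  induction x using D.Uq_induction with
  | he i => exact he i
  | hf i => exact hf i
  | hk i => exact hk i
  | hkinv i => exact hkinv i
  | hc c => exact fun v hv => by rw [algebraMap_smul]; exact S.smul_mem c hv
  | hadd x y hx hy => exact fun v hv => by rw [add_smul]; exact S.add_mem (hx v hv) (hy v hv)
  | hmul x y hx hy => exact fun v hv => by rw [mul_smul]; exact hx _ (hy v hv)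

theorem sigma_sigma (x : D.Uq) : D.sigma (D.sigma x) = x := by
  induction x using D.Uq_induction with
  | he i => rw [sigma_e, sigma_f]
  | hf i => rw [sigma_f, sigma_e]
  | hk i => rw [sigma_k, sigma_kinv]
  | hkinv i => rw [sigma_kinv, sigma_k]
  | hc c => simp
  | hadd x y hx hy => simp [hx, hy]
  | hmul x y hx hy => simp [hx, hy]

theorem antipodeInv_algebraMap (c : ℂ) :
    D.antipodeInv (algebraMap ℂ D.Uq c) = algebraMap ℂ D.Uq c := by
  simp [antipodeInv, MulOpposite.algebraMap_apply]

theorem omega_algebraMap (c : ℂ) : D.omega (algebraMap ℂ D.Uq c) = algebraMap ℂ D.Uq c := by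
  simp [omega, antipodeInv_algebraMap]

theorem omega_one : D.omega 1 = 1 := by
  simpa using D.omega_algebraMap 1

theorem omega_mul (x y : D.Uq) : D.omega (x * y) = D.omega y * D.omega x := by
  simp [omega, antipodeInv_mul]

theorem omega_e (i : I) : D.omega (D.e i) = -(D.f i * D.k i) := by
  simp [omega, sigma_e, antipodeInv_f]

theorem omega_f (i : I) : D.omega (D.f i) = -(D.kinv i * D.e i) := by
  simp [omega, sigma_f, antipodeInv_e]

theorem omega_k (i : I) : D.omega (D.k i) = D.k i := by
  simp [omega, sigma_k, antipodeInv_kinv]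

theorem omega_kinv (i : I) : D.omega (D.kinv i) = D.kinv i := by
  simp [omega, sigma_kinv, antipodeInv_k]

theorem omega_omega (x : D.Uq) : D.omega (D.omega x) = x := by
  induction x using D.Uq_induction with
  | he i =>
    rw [omega_e, map_neg, omega_mul, omega_k, omega_f, mul_neg, neg_neg, ← mul_assoc, k_mul_kinv,
      one_mul]
  | hf i =>
    rw [omega_f, map_neg, omega_mul, omega_kinv, omega_e, neg_mul, neg_neg, mul_assoc, k_mul_kinv,
      mul_one]
  | hk i => rw [omega_k, omega_k]
  | hkinv i => rw [omega_kinv, omega_kinv]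
  | hc c => rw [omega_algebraMap, omega_algebraMap]
  | hadd x y hx hy => rw [map_add, map_add, hx, hy]
  | hmul x y hx hy => rw [omega_mul, omega_mul, hx, hy]

/-- This is why `γ⁻¹` appears in the twist: intertwiners replace `x` by `σ(x)`, and contravariance
then applies `ω`. -/
theorem omega_sigma (x : D.Uq) : D.omega (D.sigma x) = D.antipodeInv x := by
  simp [omega, sigma_sigma]

/-! ### The triangular decomposition -/

/-- A product of the generators `f_α`. -/
def fWord (l : List I) : D.Uq := (l.map D.f).prod

/-- A product of the generators `e_α`. -/
def eWord (l : List I) : D.Uq := (l.map D.e).prod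

@[simp] theorem fWord_nil : D.fWord [] = 1 := rfl
@[simp] theorem eWord_nil : D.eWord [] = 1 := rfl

theorem fWord_cons (i : I) (l : List I) : D.fWord (i :: l) = D.f i * D.fWord l := by
  simp [fWord]

theorem eWord_cons (i : I) (l : List I) : D.eWord (i :: l) = D.e i * D.eWord l := by
  simp [eWord]

theorem eWord_concat (i : I) (l : List I) : D.eWord (l ++ [i]) = D.eWord l * D.e i := by
  simp [eWord]

theorem sigma_fWord (l : List I) : D.sigma (D.fWord l) = D.eWord l := by
  induction l with
  | nil => simp
  | cons i l ih => rw [fWord_cons, eWord_cons, map_mul, sigma_f, ih]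

/-- The subalgebra generated by the `q ^ {± h_α}`. -/
def cartanPart : Subalgebra ℂ D.Uq := Algebra.adjoin ℂ (Set.range D.k ∪ Set.range D.kinv)

theorem k_mem_cartanPart (i : I) : D.k i ∈ D.cartanPart :=
  Algebra.subset_adjoin (Or.inl ⟨i, rfl⟩)

theorem kinv_mem_cartanPart (i : I) : D.kinv i ∈ D.cartanPart :=
  Algebra.subset_adjoin (Or.inr ⟨i, rfl⟩)

theorem cartanPart_mul_f {κ : D.Uq} (hκ : κ ∈ D.cartanPart) (j : I) :
    ∃ κ' ∈ D.cartanPart, κ * D.f j = D.f j * κ' := by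
  induction hκ using Algebra.adjoin_induction with
  | mem x hx =>
    obtain ⟨i, rfl⟩ | ⟨i, rfl⟩ := hx
    · exact ⟨_, D.cartanPart.smul_mem (D.k_mem_cartanPart i) _,
        by rw [k_mul_f, mul_smul_comm]⟩
    · exact ⟨_, D.cartanPart.smul_mem (D.kinv_mem_cartanPart i) _,
        by rw [kinv_mul_f, mul_smul_comm]⟩
  | algebraMap c => exact ⟨_, algebraMap_mem _ c, Algebra.commutes c _⟩
  | add x y _ _ hx hy =>
    obtain ⟨x', hx', h1⟩ := hx
    obtain ⟨y', hy', h2⟩ := hy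
    exact ⟨_, add_mem hx' hy', by rw [add_mul, h1, h2, mul_add]⟩
  | mul x y _ _ hx hy =>
    obtain ⟨x', hx', h1⟩ := hx
    obtain ⟨y', hy', h2⟩ := hy
    exact ⟨_, mul_mem hx' hy', by rw [mul_assoc, h2, ← mul_assoc, h1, mul_assoc]⟩

theorem e_mul_cartanPart {κ : D.Uq} (hκ : κ ∈ D.cartanPart) (j : I) :
    ∃ κ' ∈ D.cartanPart, D.e j * κ = κ' * D.e j := by
  induction hκ using Algebra.adjoin_induction with
  | mem x hx =>
    obtain ⟨i, rfl⟩ | ⟨i, rfl⟩ := hx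
    · exact ⟨_, D.cartanPart.smul_mem (D.k_mem_cartanPart i) _,
        by rw [e_mul_k, smul_mul_assoc]⟩
    · exact ⟨_, D.cartanPart.smul_mem (D.kinv_mem_cartanPart i) _,
        by rw [e_mul_kinv, smul_mul_assoc]⟩
  | algebraMap c => exact ⟨_, algebraMap_mem _ c, (Algebra.commutes c _).symm⟩
  | add x y _ _ hx hy =>
    obtain ⟨x', hx', h1⟩ := hx
    obtain ⟨y', hy', h2⟩ := hy
    exact ⟨_, add_mem hx' hy', by rw [mul_add, h1, h2, add_mul]⟩
  | mul x y _ _ hx hy =>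
    obtain ⟨x', hx', h1⟩ := hx
    obtain ⟨y', hy', h2⟩ := hy
    exact ⟨_, mul_mem hx' hy', by rw [← mul_assoc, h1, mul_assoc, h2, mul_assoc]⟩

theorem cartanPart_mul_fWord {κ : D.Uq} (hκ : κ ∈ D.cartanPart) (l : List I) :
    ∃ κ' ∈ D.cartanPart, κ * D.fWord l = D.fWord l * κ' := by
  induction l generalizing κ with
  | nil => exact ⟨κ, hκ, by simp⟩
  | cons i l ih =>
    obtain ⟨κ₁, h₁, e₁⟩ := D.cartanPart_mul_f hκ i
    obtain ⟨κ₂, h₂, e₂⟩ := ih h₁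
    exact ⟨κ₂, h₂, by rw [fWord_cons, ← mul_assoc, e₁, mul_assoc, e₂, mul_assoc]⟩

theorem e_mul_f_sub_mem_cartanPart (i j : I) :
    D.e i * D.f j - D.f j * D.e i ∈ D.cartanPart := by
  by_cases h : i = j
  · subst h
    rw [e_mul_f_same]
    exact D.cartanPart.smul_mem (sub_mem (D.k_mem_cartanPart i) (D.kinv_mem_cartanPart i)) _
  · rw [D.e_mul_f_ne h]
    exact zero_mem _

/-- Commuting `e_α` past a product of `f`'s produces shorter products of `f`'s. -/
theorem e_mul_fWord_sub_mem (i : I) (l : List I) :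
    D.e i * D.fWord l - D.fWord l * D.e i ∈ Submodule.span ℂ
      {x | ∃ (m : List I) (κ : D.Uq), m.length < l.length ∧ κ ∈ D.cartanPart ∧
        x = D.fWord m * κ} := by
  induction l with
  | nil => simp
  | cons j l ih =>
    have e1 : D.e i * D.fWord (j :: l) - D.fWord (j :: l) * D.e i
        = (D.e i * D.f j - D.f j * D.e i) * D.fWord l
          + D.f j * (D.e i * D.fWord l - D.fWord l * D.e i) := by
      rw [fWord_cons]; noncomm_ring
    rw [e1]
    refine add_mem ?_ ?_
    · obtain ⟨κ, hκ, h⟩ := D.cartanPart_mul_fWord (D.e_mul_f_sub_mem_cartanPart i j) l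
      rw [h]
      exact Submodule.subset_span ⟨l, κ, by simp, hκ, rfl⟩
    · generalize D.e i * D.fWord l - D.fWord l * D.e i = y at ih
      induction ih using Submodule.span_induction with
      | mem x hx =>
        obtain ⟨m, κ, hm, hκ, rfl⟩ := hx
        exact Submodule.subset_span ⟨j :: m, κ, by simpa using hm, hκ,
          by rw [fWord_cons, mul_assoc]⟩
      | zero => simp
      | add x y _ _ hx hy => rw [mul_add]; exact add_mem hx hy
      | smul c x _ hx => rw [mul_smul_comm]; exact Submodule.smul_mem _ c hx

/-- The span contains `1` and is stable under left multiplication by the generators. Only `e_α`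
needs work: it must pass the `f`-word, which costs terms with shorter words. -/
theorem span_triangular_eq_top :
    Submodule.span ℂ {x : D.Uq | ∃ (l : List I) (κ : D.Uq) (l' : List I), κ ∈ D.cartanPart ∧
      x = D.fWord l * κ * D.eWord l'} = ⊤ := by
  set T := Submodule.span ℂ {x : D.Uq | ∃ (l : List I) (κ : D.Uq) (l' : List I),
    κ ∈ D.cartanPart ∧ x = D.fWord l * κ * D.eWord l'} with hT
  have stable : ∀ a : D.Uq, (∀ (l : List I) (κ : D.Uq) (l' : List I), κ ∈ D.cartanPart →
      a * (D.fWord l * κ * D.eWord l') ∈ T) → ∀ x ∈ T, a • x ∈ T := by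
    intro a ha x hx
    induction hx using Submodule.span_induction with
    | mem x hx =>
      obtain ⟨l, κ, l', hκ, rfl⟩ := hx
      exact ha l κ l' hκ
    | zero => simp
    | add x y _ _ hx hy => rw [smul_add]; exact add_mem hx hy
    | smul c x _ hx => rw [smul_algebra_smul_comm]; exact Submodule.smul_mem _ c hx
  have hcartan : ∀ a ∈ D.cartanPart, ∀ (l : List I) (κ : D.Uq) (l' : List I), κ ∈ D.cartanPart →
      a * (D.fWord l * κ * D.eWord l') ∈ T := by
    intro a ha l κ l' hκ
    obtain ⟨κ', hκ', h⟩ := D.cartanPart_mul_fWord ha l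
    refine Submodule.subset_span ⟨l, κ' * κ, l', mul_mem hκ' hκ, ?_⟩
    rw [← mul_assoc, ← mul_assoc, h, mul_assoc (D.fWord l)]
  have main := D.smul_mem_of_generators T (fun i => stable _ ?_) (fun i => stable _ ?_)
    (fun i => stable _ (hcartan _ (D.k_mem_cartanPart i)))
    (fun i => stable _ (hcartan _ (D.kinv_mem_cartanPart i)))
  · refine eq_top_iff.mpr fun x _ => ?_
    have := main x 1 (Submodule.subset_span ⟨[], 1, [], one_mem _, by simp⟩)
    simpa using this
  · intro l κ l' hκ
    have e1 : D.e i * (D.fWord l * κ * D.eWord l')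
        = D.fWord l * (D.e i * κ) * D.eWord l'
          + (D.e i * D.fWord l - D.fWord l * D.e i) * (κ * D.eWord l') := by
      noncomm_ring
    rw [e1]
    refine add_mem ?_ ?_
    · obtain ⟨κ', hκ', h⟩ := D.e_mul_cartanPart hκ i
      rw [h]
      exact Submodule.subset_span ⟨l, κ', i :: l', hκ', by simp only [eWord_cons, mul_assoc]⟩
    · have := D.e_mul_fWord_sub_mem i l
      generalize D.e i * D.fWord l - D.fWord l * D.e i = y at this
      induction this using Submodule.span_induction with
      | mem x hx =>
        obtain ⟨m, κ', hm, hκ', rfl⟩ := hx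
        exact Submodule.subset_span ⟨m, κ' * κ, l', mul_mem hκ' hκ, by simp only [mul_assoc]⟩
      | zero => simp
      | add x y _ _ hx hy => rw [add_mul]; exact add_mem hx hy
      | smul c x _ hx => rw [smul_mul_assoc]; exact Submodule.smul_mem _ c hx
  · intro l κ l' hκ
    exact Submodule.subset_span ⟨i :: l, κ, l', hκ, by simp only [fWord_cons, mul_assoc]⟩

end QuantumDatum

/-! ### Joint eigenspaces -/

/-- The joint eigenspace of a family of endomorphisms. -/
def jointEigenspace {ι M : Type*} [AddCommGroup M] [Module ℂ M] (T : ι → Module.End ℂ M)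
    (χ : ι → ℂ) : Submodule ℂ M := ⨅ i, (T i).eigenspace (χ i)

theorem mem_jointEigenspace {ι M : Type*} [AddCommGroup M] [Module ℂ M]
    {T : ι → Module.End ℂ M} {χ : ι → ℂ} {v : M} :
    v ∈ jointEigenspace T χ ↔ ∀ i, T i v = χ i • v := by
  simp [jointEigenspace]

/-- Commuting operators preserve each other's generalized eigenspaces, whose intersections are
independent; joint eigenspaces are smaller still. -/
theorem iSupIndep_jointEigenspace {ι M : Type*} [AddCommGroup M] [Module ℂ M]
    {T : ι → Module.End ℂ M} (hT : ∀ i j, Commute (T i) (T j)) :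
    iSupIndep (jointEigenspace T) := by
  refine (Module.End.independent_iInf_maxGenEigenspace_of_forall_mapsTo T
    fun i j φ => Module.End.mapsTo_maxGenEigenspace_of_comm (hT j i) φ).mono fun χ => ?_
  exact iInf_mono fun i => Module.End.eigenspace_le_maxGenEigenspace

namespace QuantumDatum

variable {I P : Type*} [AddCommGroup P] [Module ℂ P] (D : QuantumDatum I P)

/-! ### Highest weight modules -/

section OneModule

variable {Z : Type*} [AddCommGroup Z] [Module ℂ Z] [Module D.Uq Z] [IsScalarTower ℂ D.Uq Z]

/-- No weight `-∑ n_α α` with natural `n_α`, not all zero, acts trivially on the Cartan part. -/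
def SeparatesRoots : Prop :=
  ∀ n : I →₀ ℕ, n ≠ 0 → ∃ i, D.qpow (D.form (D.root i) (n.sum fun j a => a • D.root j)) ≠ 1

theorem qpow_add (x y : ℂ) : D.qpow (x + y) = D.qpow x * D.qpow y := by
  simp [qpow, mul_add, Complex.exp_add]

theorem qpow_ne_zero (x : ℂ) : D.qpow x ≠ 0 := Complex.exp_ne_zero _

variable {D} in
theorem SeparatesRoots.exists_ne (hs : D.SeparatesRoots) {n : I →₀ ℕ} (hn : n ≠ 0) (ζ : P) :
    ∃ i, D.qpow (D.form (D.root i) (ζ - n.sum fun j a => a • D.root j))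
      ≠ D.qpow (D.form (D.root i) ζ) := by
  obtain ⟨i, hi⟩ := hs n hn
  refine ⟨i, fun h => hi ?_⟩
  set x := n.sum fun j a => a • D.root j
  have h1 : D.qpow (D.form (D.root i) ζ)
      = D.qpow (D.form (D.root i) (ζ - x)) * D.qpow (D.form (D.root i) x) := by
    rw [← qpow_add, map_sub, sub_add_cancel]
  rw [h] at h1
  exact mul_left_cancel₀ (D.qpow_ne_zero (D.form (D.root i) ζ)) (by rw [← h1, mul_one])

theorem f_smul_mem_weightSpace (j : I) {μ : P} {z : Z} (hz : z ∈ D.weightSpace Z μ) :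
    D.f j • z ∈ D.weightSpace Z (μ - D.root j) := by
  intro i
  rw [← mul_smul, k_mul_f, smul_assoc, mul_smul, hz i, smul_algebra_smul_comm, smul_smul,
    ← qpow_add, map_sub, sub_eq_neg_add]

/-- The multiplicities of the letters of a word. -/
def content (l : List I) : I →₀ ℕ := (l.map fun i => Finsupp.single i 1).sum

theorem content_cons (i : I) (l : List I) :
    content (i :: l) = Finsupp.single i 1 + content l := by
  simp [content]

theorem content_cons_ne_zero (i : I) (l : List I) : content (i :: l) ≠ 0 := by
  rw [content_cons]
  intro h
  have := DFunLike.congr_fun h i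
  simp at this

theorem fWord_smul_mem_weightSpace (l : List I) {μ : P} {z : Z} (hz : z ∈ D.weightSpace Z μ) :
    D.fWord l • z ∈ D.weightSpace Z (μ - (content l).sum fun i a => a • D.root i) := by
  induction l with
  | nil => simpa [content] using hz
  | cons i l ih =>
    classical
    rw [fWord_cons, mul_smul, content_cons, Finsupp.sum_add_index' (by simp)
      (by simp [add_smul]), Finsupp.sum_single_index (by simp), one_smul, add_comm, ← sub_sub]
    exact D.f_smul_mem_weightSpace i ih

theorem kinv_smul_of_k_smul {i : I} {c : ℂ} (hc : c ≠ 0) {z : Z} (h : D.k i • z = c • z) :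
    D.kinv i • z = c⁻¹ • z := by
  have h1 : D.kinv i • D.k i • z = z := by rw [← mul_smul, kinv_mul_k, one_smul]
  rw [h, smul_algebra_smul_comm] at h1
  rw [eq_inv_smul_iff₀ hc, h1]

variable {D} {z₀ : Z} {ζ : P}

namespace IsHighestWeight

variable (hZ : D.IsHighestWeight z₀ ζ)
include hZ

theorem kinv_smul (i : I) : D.kinv i • z₀ = (D.qpow (D.form (D.root i) ζ))⁻¹ • z₀ :=
  D.kinv_smul_of_k_smul (D.qpow_ne_zero _) (hZ.mem_weightSpace i)

theorem exists_smul_eq (z : Z) : ∃ x : D.Uq, x • z₀ = z :=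
  Submodule.mem_span_singleton.mp (hZ.cyclic ▸ Submodule.mem_top)

/-- Elements of the Cartan part and their images under `ω` act on the highest vector by the same
scalar. -/
theorem exists_cartanPart_smul {κ : D.Uq} (hκ : κ ∈ D.cartanPart) :
    ∃ c : ℂ, κ • z₀ = c • z₀ ∧ D.omega κ • z₀ = c • z₀ := by
  induction hκ using Algebra.adjoin_induction with
  | mem x hx =>
    obtain ⟨i, rfl⟩ | ⟨i, rfl⟩ := hx
    · exact ⟨_, hZ.mem_weightSpace i, by rw [omega_k]; exact hZ.mem_weightSpace i⟩
    · exact ⟨_, hZ.kinv_smul i, by rw [omega_kinv]; exact hZ.kinv_smul i⟩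
  | algebraMap c => exact ⟨c, algebraMap_smul _ c _, by rw [omega_algebraMap, algebraMap_smul]⟩
  | add x y _ _ hx hy =>
    obtain ⟨a, h1, h2⟩ := hx
    obtain ⟨b, h3, h4⟩ := hy
    exact ⟨a + b, by rw [add_smul, add_smul, h1, h3], by rw [map_add, add_smul, add_smul, h2, h4]⟩
  | mul x y _ _ hx hy =>
    obtain ⟨a, h1, h2⟩ := hx
    obtain ⟨b, h3, h4⟩ := hy
    exact ⟨a * b, by rw [mul_smul, h3, smul_algebra_smul_comm, h1, smul_smul, mul_comm],
      by rw [omega_mul, mul_smul, h2, smul_algebra_smul_comm, h4, smul_smul]⟩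

theorem eWord_cons_smul (i : I) (l : List I) : D.eWord (i :: l) • z₀ = 0 := by
  obtain ⟨l', j, h⟩ : ∃ l' j, i :: l = l' ++ [j] := by
    have := List.eq_nil_or_concat (i :: l)
    simpa using this
  rw [h, eWord_concat, mul_smul, hZ.e_smul, smul_zero]

theorem span_fWord_smul : Submodule.span ℂ (Set.range fun l => D.fWord l • z₀) = ⊤ := by
  refine Submodule.eq_top_iff'.mpr fun z => ?_
  obtain ⟨x, rfl⟩ := hZ.exists_smul_eq z
  have hx : x ∈ Submodule.span ℂ _ := D.span_triangular_eq_top ▸ Submodule.mem_top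
  induction hx using Submodule.span_induction with
  | mem x hx =>
    obtain ⟨l, κ, l', hκ, rfl⟩ := hx
    cases l' with
    | nil =>
      obtain ⟨c, hc, -⟩ := hZ.exists_cartanPart_smul hκ
      rw [eWord_nil, mul_one, mul_smul, hc, smul_algebra_smul_comm]
      exact Submodule.smul_mem _ _ (Submodule.subset_span ⟨l, rfl⟩)
    | cons i l' => simp [mul_smul, hZ.eWord_cons_smul]
  | zero => simp
  | add x y _ _ hx hy => rw [add_smul]; exact add_mem hx hy
  | smul c x _ hx => rw [smul_assoc]; exact Submodule.smul_mem _ _ hx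

theorem fWord_induction {p : Z → Prop} (hw : ∀ l, p (D.fWord l • z₀)) (hzero : p 0)
    (hadd : ∀ x y, p x → p y → p (x + y)) (hsmul : ∀ (c : ℂ) x, p x → p (c • x)) (z : Z) :
    p z := by
  have hz : z ∈ Submodule.span ℂ (Set.range fun l => D.fWord l • z₀) :=
    hZ.span_fWord_smul ▸ Submodule.mem_top
  induction hz using Submodule.span_induction with
  | mem x hx => obtain ⟨l, rfl⟩ := hx; exact hw l
  | zero => exact hzero
  | add x y _ _ hx hy => exact hadd x y hx hy
  | smul c x _ hx => exact hsmul c x hx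

end IsHighestWeight

variable (D) in
/-- The span of the images of the `f_α`. -/
def fImage (Z : Type*) [AddCommGroup Z] [Module ℂ Z] [Module D.Uq Z] : Submodule ℂ Z :=
  Submodule.span ℂ {w | ∃ (i : I) (z : Z), w = D.f i • z}

/-- Applying `f_α` to a word makes it non-empty, so its content is non-zero and its weight is
strictly below `ζ`. -/
theorem IsHighestWeight.fImage_le (hZ : D.IsHighestWeight z₀ ζ) :
    D.fImage Z ≤ Submodule.span ℂ {w | ∃ (n : I →₀ ℕ), n ≠ 0 ∧
      w ∈ D.weightSpace Z (ζ - n.sum fun i a => a • D.root i)} := by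
  refine Submodule.span_le.mpr ?_
  rintro _ ⟨i, z, rfl⟩
  change D.f i • z ∈ Submodule.span ℂ _
  induction z using hZ.fWord_induction with
  | hw l =>
    rw [← mul_smul, ← fWord_cons]
    exact Submodule.subset_span ⟨_, content_cons_ne_zero i l,
      D.fWord_smul_mem_weightSpace _ hZ.mem_weightSpace⟩
  | hzero => simp
  | hadd x y hx hy => rw [smul_add]; exact add_mem hx hy
  | hsmul c x hx => rw [smul_algebra_smul_comm]; exact Submodule.smul_mem _ _ hx

theorem commute_lsmul_k (i j : I) :
    Commute (Algebra.lsmul ℂ ℂ Z (D.k i)) (Algebra.lsmul ℂ ℂ Z (D.k j)) := by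
  rw [commute_iff_eq, ← map_mul, ← map_mul, k_mul_k]

/-- The image of the `f_α` lies in joint eigenspaces of the `q ^ {h_α}` whose characters differ from
that of `ζ`, and distinct joint eigenspaces are independent. -/
theorem IsHighestWeight.notMem_fImage (hZ : D.IsHighestWeight z₀ ζ) (hs : D.SeparatesRoots) :
    z₀ ∉ D.fImage Z := by
  intro hmem
  have hind := iSupIndep_jointEigenspace (fun i j => commute_lsmul_k (D := D) (Z := Z) i j)
  have hdis := hind fun i => D.qpow (D.form (D.root i) ζ)
  refine hZ.ne_zero (Submodule.disjoint_def.mp hdis z₀ ?_ ?_)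
  · exact mem_jointEigenspace.mpr hZ.mem_weightSpace
  · refine (hZ.fImage_le.trans (Submodule.span_le.mpr ?_)) hmem
    rintro w ⟨n, hn, hw⟩
    obtain ⟨i, hi⟩ := hs.exists_ne hn ζ
    refine Submodule.mem_iSup_of_mem
      (fun i => D.qpow (D.form (D.root i) (ζ - n.sum fun i a => a • D.root i)))
      (Submodule.mem_iSup_of_mem (fun h => hi (congrFun h i)) ?_)
    exact mem_jointEigenspace.mpr hw

variable (D z₀) in
/-- A functional that is `1` on the highest vector and vanishes on the other weight spaces. -/
structure IsVacuum (φ : Module.Dual ℂ Z) : Prop where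
  apply_hw : φ z₀ = 1
  apply_f : ∀ (i : I) (z : Z), φ (D.f i • z) = 0

theorem IsHighestWeight.exists_isVacuum (hZ : D.IsHighestWeight z₀ ζ) (hs : D.SeparatesRoots) :
    ∃ φ, D.IsVacuum z₀ φ := by
  obtain ⟨φ, h1, h2⟩ := Submodule.exists_le_ker_of_notMem (hZ.notMem_fImage hs)
  refine ⟨(φ z₀)⁻¹ • φ, by simp [h1], fun i z => ?_⟩
  have : D.f i • z ∈ LinearMap.ker φ := h2 (Submodule.subset_span ⟨i, z, rfl⟩)
  simp [LinearMap.mem_ker.mp this]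

theorem IsHighestWeight.omega_f_smul (hZ : D.IsHighestWeight z₀ ζ) (i : I) :
    D.omega (D.f i) • z₀ = 0 := by
  rw [omega_f, neg_smul, mul_smul, hZ.e_smul, smul_zero, neg_zero]

omit [IsScalarTower ℂ D.Uq Z] in
theorem IsVacuum.omega_e_smul {φ : Module.Dual ℂ Z} (hφ : D.IsVacuum z₀ φ) (i : I) (z : Z) :
    φ (D.omega (D.e i) • z) = 0 := by
  rw [omega_e, neg_smul, mul_smul, map_neg, hφ.apply_f, neg_zero]

/-- On a triangular monomial with an `e` at the right end or an `f` at the left end both sides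
vanish, because `ω` exchanges these two situations. What remains is the Cartan part, where `ω` does
not change the scalar. This is the source of the symmetry of the Shapovalov form. -/
theorem IsHighestWeight.vacuum_omega (hZ : D.IsHighestWeight z₀ ζ) {φ : Module.Dual ℂ Z}
    (hφ : D.IsVacuum z₀ φ) (u : D.Uq) : φ (D.omega u • z₀) = φ (u • z₀) := by
  have hu : u ∈ Submodule.span ℂ _ := D.span_triangular_eq_top ▸ Submodule.mem_top
  induction hu using Submodule.span_induction with
  | mem x hx =>
    obtain ⟨l, κ, l', hκ, rfl⟩ := hx
    obtain rfl | ⟨l'', j, rfl⟩ := List.eq_nil_or_concat' l'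
    · cases l with
      | nil =>
        obtain ⟨c, h1, h2⟩ := hZ.exists_cartanPart_smul hκ
        simp [h1, h2]
      | cons i l =>
        simp only [fWord_cons, eWord_nil, mul_one, mul_assoc]
        rw [omega_mul, mul_smul, hZ.omega_f_smul, mul_smul, hφ.apply_f, smul_zero, map_zero]
    · rw [eWord_concat, ← mul_assoc, omega_mul, mul_smul, hφ.omega_e_smul, mul_smul, hZ.e_smul,
        smul_zero, map_zero]
  | zero => simp
  | add x y _ _ hx hy => simp [add_smul, hx, hy]
  | smul c x _ hx => simp [hx]

/-! ### Shapovalov forms -/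

theorem IsHighestWeight.exists_isShapovalovForm (hZ : D.IsHighestWeight z₀ ζ)
    (hs : D.SeparatesRoots) : ∃ B, D.IsShapovalovForm z₀ B := by
  obtain ⟨φ, hφ⟩ := hZ.exists_isVacuum hs
  have symm (x y : D.Uq) : φ (D.omega x • y • z₀) = φ (D.omega y • x • z₀) := by
    rw [← mul_smul, ← hZ.vacuum_omega hφ, omega_mul, omega_omega, mul_smul]
  -- A linear section `s` picks, for each `z`, some `x` with `x • z₀ = z`, so that the form can be
  -- defined before independence of the choice is known.
  obtain ⟨s, hs⟩ := ((LinearMap.toSpanSingleton D.Uq Z z₀).restrictScalars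
    ℂ).exists_rightInverse_of_surjective (LinearMap.range_eq_top.mpr hZ.exists_smul_eq)
  have hs' (z : Z) : s z • z₀ = z := LinearMap.congr_fun hs z
  let B : LinearMap.BilinForm ℂ Z := LinearMap.mk₂ ℂ (fun z w => φ (D.omega (s z) • w))
    (fun _ _ _ => by simp [add_smul]) (fun _ _ _ => by simp) (fun _ _ _ => by simp)
    (fun c m n => by rw [smul_algebra_smul_comm, map_smul])
  -- Independence of the section: `symm` moves the chosen representative to the side where only its
  -- action on `z₀` matters, and a second use moves `x` back.
  have hB (x : D.Uq) (w : Z) : B (x • z₀) w = φ (D.omega x • w) := by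
    obtain ⟨y, rfl⟩ := hZ.exists_smul_eq w
    change φ (D.omega (s (x • z₀)) • y • z₀) = _
    rw [symm, hs', symm]
  refine ⟨B, fun v w => ?_, fun x v w => ?_, ?_⟩
  · obtain ⟨x, rfl⟩ := hZ.exists_smul_eq v
    obtain ⟨y, rfl⟩ := hZ.exists_smul_eq w
    rw [hB, hB, symm]
  · obtain ⟨y, rfl⟩ := hZ.exists_smul_eq v
    rw [← mul_smul, hB, hB, omega_mul, mul_smul]
  · have := hB 1 z₀
    rwa [one_smul, omega_one, one_smul, hφ.apply_hw] at this

namespace IsShapovalovForm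

variable {B : LinearMap.BilinForm ℂ Z} (hB : D.IsShapovalovForm z₀ B)
include hB

omit [IsScalarTower ℂ D.Uq Z] in
theorem contravariant' (x : D.Uq) (v w : Z) : B v (x • w) = B (D.omega x • v) w := by
  rw [hB.contravariant, omega_omega]

theorem isVacuum (hZ : D.IsHighestWeight z₀ ζ) : D.IsVacuum z₀ (B z₀) :=
  ⟨hB.normalized, fun i z => by simp [hB.contravariant', hZ.omega_f_smul]⟩

/-- Pairing with the highest vector is forced, being `1` on it and `0` on non-empty `f`-words;
contravariance and cyclicity then determine the whole form. -/
theorem eq_of_isShapovalovForm (hZ : D.IsHighestWeight z₀ ζ) {B' : LinearMap.BilinForm ℂ Z}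
    (hB' : D.IsShapovalovForm z₀ B') : B' = B := by
  have h0 (w : Z) : B' z₀ w = B z₀ w := by
    induction w using hZ.fWord_induction with
    | hw l =>
      cases l with
      | nil => simp [hB.normalized, hB'.normalized]
      | cons i l =>
        rw [fWord_cons, mul_smul, (hB.isVacuum hZ).apply_f, (hB'.isVacuum hZ).apply_f]
    | hzero => simp
    | hadd x y hx hy => simp [hx, hy]
    | hsmul c x hx => simp [hx]
  ext v w
  obtain ⟨x, rfl⟩ := hZ.exists_smul_eq v
  rw [hB.contravariant, hB'.contravariant, h0]

omit [IsScalarTower ℂ D.Uq Z] in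
/-- The Shapovalov form of an irreducible module is non-degenerate. -/
theorem eq_zero_of_forall [IsSimpleModule D.Uq Z] {v : Z} (hv : ∀ w, B v w = 0) : v = 0 := by
  let R : Submodule D.Uq Z :=
    { carrier := {v | ∀ w, B v w = 0}
      add_mem' := fun ha hb w => by rw [map_add, LinearMap.add_apply, ha w, hb w, add_zero]
      zero_mem' := fun w => by simp
      smul_mem' := fun x v hv w => by rw [hB.contravariant]; exact hv _ }
  have hmem : v ∈ R := hv
  obtain h | h := eq_bot_or_eq_top R
  · simpa [h] using hmem
  · have : z₀ ∈ R := h ▸ Submodule.mem_top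
    have := this z₀
    simp [hB.normalized] at this

/-- Since `ω` fixes `q ^ {h_α}`, weight vectors with different eigenvalues are orthogonal. -/
theorem apply_weightSpace_eq_zero (hs : D.SeparatesRoots) (hZ : D.IsHighestWeight z₀ ζ)
    {n : I →₀ ℕ} (hn : n ≠ 0) {z : Z}
    (hz : z ∈ D.weightSpace Z (ζ - n.sum fun i a => a • D.root i)) : B z₀ z = 0 := by
  obtain ⟨i, hi⟩ := hs.exists_ne hn ζ
  have h1 := hB.contravariant (D.k i) z₀ z
  rw [omega_k, hZ.mem_weightSpace i, hz i, map_smul, map_smul, LinearMap.smul_apply,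
    smul_eq_mul, smul_eq_mul] at h1
  by_contra h
  exact hi (mul_right_cancel₀ h h1).symm

end IsShapovalovForm

/-! ### The filtration by the length of words -/

variable (D z₀) in
/-- The span of the vectors obtained from `z₀` by less than `m` of the `f_α`. -/
def wordFiltration (m : ℕ) : Submodule ℂ Z :=
  Submodule.span ℂ {z | ∃ l : List I, l.length < m ∧ z = D.fWord l • z₀}

omit [IsScalarTower ℂ D.Uq Z] in
theorem wordFiltration_mono : Monotone (D.wordFiltration z₀) := fun _ _ h =>
  Submodule.span_mono fun _ ⟨l, hl, e⟩ => ⟨l, hl.trans_le h, e⟩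

omit [IsScalarTower ℂ D.Uq Z] in
@[simp] theorem wordFiltration_zero : D.wordFiltration z₀ 0 = ⊥ := by
  simp [wordFiltration]

theorem IsHighestWeight.exists_mem_wordFiltration (hZ : D.IsHighestWeight z₀ ζ) (z : Z) :
    ∃ m, z ∈ D.wordFiltration z₀ m := by
  induction z using hZ.fWord_induction with
  | hw l => exact ⟨l.length + 1, Submodule.subset_span ⟨l, by simp, rfl⟩⟩
  | hzero => exact ⟨0, zero_mem _⟩
  | hadd x y hx hy =>
    obtain ⟨a, ha⟩ := hx
    obtain ⟨b, hb⟩ := hy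
    exact ⟨max a b, add_mem (wordFiltration_mono (le_max_left a b) ha)
      (wordFiltration_mono (le_max_right a b) hb)⟩
  | hsmul c x hx =>
    obtain ⟨a, ha⟩ := hx
    exact ⟨a, Submodule.smul_mem _ _ ha⟩

theorem IsHighestWeight.fWord_mul_cartanPart_smul_mem (hZ : D.IsHighestWeight z₀ ζ) {l : List I}
    {m : ℕ} (hl : l.length < m) {κ : D.Uq} (hκ : κ ∈ D.cartanPart) :
    (D.fWord l * κ) • z₀ ∈ D.wordFiltration z₀ m := by
  obtain ⟨c, hc, -⟩ := hZ.exists_cartanPart_smul hκ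
  rw [mul_smul, hc, smul_algebra_smul_comm]
  exact Submodule.smul_mem _ _ (Submodule.subset_span ⟨l, hl, rfl⟩)

theorem smul_mem_wordFiltration_of_fWord {m m' : ℕ} {x : D.Uq}
    (h : ∀ l : List I, l.length < m → (x * D.fWord l) • z₀ ∈ D.wordFiltration z₀ m')
    {z : Z} (hz : z ∈ D.wordFiltration z₀ m) : x • z ∈ D.wordFiltration z₀ m' := by
  induction hz using Submodule.span_induction with
  | mem y hy => obtain ⟨l, hl, rfl⟩ := hy; rw [← mul_smul]; exact h l hl
  | zero => simp
  | add x y _ _ hx hy => rw [smul_add]; exact add_mem hx hy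
  | smul c y _ hy => rw [smul_algebra_smul_comm]; exact Submodule.smul_mem _ _ hy

theorem IsHighestWeight.cartanPart_smul_mem_wordFiltration (hZ : D.IsHighestWeight z₀ ζ)
    {κ : D.Uq} (hκ : κ ∈ D.cartanPart) {m : ℕ} {z : Z} (hz : z ∈ D.wordFiltration z₀ m) :
    κ • z ∈ D.wordFiltration z₀ m := by
  refine smul_mem_wordFiltration_of_fWord (fun l hl => ?_) hz
  obtain ⟨κ', hκ', h⟩ := D.cartanPart_mul_fWord hκ l
  rw [h]
  exact hZ.fWord_mul_cartanPart_smul_mem hl hκ'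

/-- As `e_α` kills `z₀`, only its commutator with the word survives, and that consists of strictly
shorter words up to Cartan factors. -/
theorem IsHighestWeight.e_smul_mem_wordFiltration (hZ : D.IsHighestWeight z₀ ζ) (i : I) {m : ℕ}
    {z : Z} (hz : z ∈ D.wordFiltration z₀ (m + 1)) : D.e i • z ∈ D.wordFiltration z₀ m := by
  refine smul_mem_wordFiltration_of_fWord (fun l hl => ?_) hz
  have h0 : (D.e i * D.fWord l) • z₀ = (D.e i * D.fWord l - D.fWord l * D.e i) • z₀ := by
    rw [sub_smul, mul_smul (D.fWord l), hZ.e_smul, smul_zero, sub_zero]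
  rw [h0]
  have := D.e_mul_fWord_sub_mem i l
  generalize D.e i * D.fWord l - D.fWord l * D.e i = y at this
  induction this using Submodule.span_induction with
  | mem x hx =>
    obtain ⟨l', κ, hl', hκ, rfl⟩ := hx
    exact hZ.fWord_mul_cartanPart_smul_mem (by omega) hκ
  | zero => simp
  | add x y _ _ hx hy => rw [add_smul]; exact add_mem hx hy
  | smul c x _ hx => rw [smul_assoc]; exact Submodule.smul_mem _ c hx

theorem IsHighestWeight.eWord_smul_mem_wordFiltration (hZ : D.IsHighestWeight z₀ ζ) (l : List I)
    {m : ℕ} {z : Z} (hz : z ∈ D.wordFiltration z₀ (m + l.length)) :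
    D.eWord l • z ∈ D.wordFiltration z₀ m := by
  induction l generalizing m with
  | nil => simpa using hz
  | cons i l ih =>
    rw [eWord_cons, mul_smul]
    refine hZ.e_smul_mem_wordFiltration i (ih ?_)
    rwa [List.length_cons, ← add_assoc, add_right_comm] at hz

theorem IsHighestWeight.eWord_smul_eq_zero (hZ : D.IsHighestWeight z₀ ζ) {l : List I}
    {m : ℕ} (hl : m ≤ l.length) {z : Z} (hz : z ∈ D.wordFiltration z₀ m) :
    D.eWord l • z = 0 := by
  have := hZ.eWord_smul_mem_wordFiltration (m := 0) l
    (wordFiltration_mono (by omega : m ≤ 0 + l.length) hz)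
  simpa using this

/-- Contravariance turns each letter `f_α` into an `e_α` acting on `z`, and each of these drops the
filtration by one until nothing is left. Thus long words are orthogonal to the span of shorter ones.
-/
theorem IsShapovalovForm.fWord_apply_eq_zero {B : LinearMap.BilinForm ℂ Z}
    (hB : D.IsShapovalovForm z₀ B) (hZ : D.IsHighestWeight z₀ ζ) (l : List I) {z : Z}
    (hz : z ∈ D.wordFiltration z₀ l.length) : B (D.fWord l • z₀) z = 0 := by
  induction l generalizing z with
  | nil =>
    have : z = 0 := by simpa using hz
    simp [this]
  | cons i l ih =>
    rw [fWord_cons, mul_smul, hB.contravariant, omega_f]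
    refine ih ?_
    rw [neg_smul, mul_smul]
    exact neg_mem (hZ.cartanPart_smul_mem_wordFiltration (D.kinv_mem_cartanPart i)
      (hZ.e_smul_mem_wordFiltration i hz))

instance [Finite I] (m : ℕ) : FiniteDimensional ℂ (D.wordFiltration z₀ m) := by
  refine FiniteDimensional.span_of_finite ℂ (((List.finite_length_lt I m).image
    fun l => D.fWord l • z₀).subset ?_)
  rintro _ ⟨l, hl, rfl⟩
  exact ⟨l, hl, rfl⟩

end OneModule
end QuantumDatum

namespace QuantumDatum

variable {I P : Type*} [AddCommGroup P] [Module ℂ P] {D : QuantumDatum I P}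

/-! ### Contraction with the Shapovalov form of the second factor -/

section Contract

variable {V Z : Type*} [AddCommGroup V] [Module ℂ V] [AddCommGroup Z] [Module ℂ Z]

/-- The map `V ⊗ Z → Hom(Z, V)` that sends `v ⊗ z` to `y ↦ B(z, y) v`. -/
def contract (V : Type*) [AddCommGroup V] [Module ℂ V] (B : LinearMap.BilinForm ℂ Z) :
    V ⊗[ℂ] Z →ₗ[ℂ] Z →ₗ[ℂ] V :=
  TensorProduct.lift ((LinearMap.smulRightₗ ∘ₗ B).flip)

@[simp] theorem contract_tmul (B : LinearMap.BilinForm ℂ Z) (v : V) (z y : Z) :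
    contract V B (v ⊗ₜ z) y = B z y • v := rfl

/-- In a basis of `V`, the coordinates of the contraction are the functionals `B(z_j, ·)` of the
coefficients `z_j ∈ Z` of the tensor. -/
theorem contract_injective {B : LinearMap.BilinForm ℂ Z}
    (hB : ∀ z, (∀ y, B z y = 0) → z = 0) : Function.Injective (contract V B) := by
  refine (injective_iff_map_eq_zero _).mpr fun u hu => ?_
  classical
  let b := Module.Basis.ofVectorSpace ℂ V
  have key (u : V ⊗[ℂ] Z) (y : Z) j :
      b.repr (contract V B u y) j = B (TensorProduct.equivFinsuppOfBasisLeft b u j) y := by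
    induction u with
    | zero => simp
    | add x y hx hy => simp [hx, hy]
    | tmul v z => simp [TensorProduct.equivFinsuppOfBasisLeft_apply_tmul, mul_comm]
  have : TensorProduct.equivFinsuppOfBasisLeft b u = 0 := by
    ext j
    refine hB _ fun y => ?_
    rw [← key, hu]
    simp
  simpa using this

end Contract

section TwoModules

variable {V Z : Type*} [AddCommGroup V] [Module ℂ V] [Module D.Uq V]
  [IsScalarTower ℂ D.Uq V] [AddCommGroup Z] [Module ℂ Z] [Module D.Uq Z] [IsScalarTower ℂ D.Uq Z]

theorem genAction_e_tmul (i : I) (v : V) (z : Z) :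
    D.genAction V Z (.e i) (v ⊗ₜ z) = (D.e i • v) ⊗ₜ (D.k i • z) + v ⊗ₜ (D.e i • z) := by
  simp [genAction, tensorAction, comulGen, Module.endTensorEndAlgHom_apply]

theorem genAction_k_tmul (i : I) (v : V) (z : Z) :
    D.genAction V Z (.k i) (v ⊗ₜ z) = (D.k i • v) ⊗ₜ (D.k i • z) := by
  simp [genAction, tensorAction, comulGen, Module.endTensorEndAlgHom_apply]

theorem commute_genAction_k (i j : I) :
    Commute (D.genAction V Z (.k i)) (D.genAction V Z (.k j)) := by
  rw [commute_iff_eq]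
  refine TensorProduct.ext' fun v z => ?_
  simp only [Module.End.mul_apply, genAction_k_tmul, ← mul_smul, D.k_mul_k i j]

theorem genAction_k_e (i j : I) (u : V ⊗[ℂ] Z) :
    D.genAction V Z (.k i) (D.genAction V Z (.e j) u)
      = D.qpow (D.form (D.root i) (D.root j)) •
        D.genAction V Z (.e j) (D.genAction V Z (.k i) u) := by
  induction u with
  | zero => simp
  | add x y hx hy => simp [hx, hy]
  | tmul v z =>
    simp only [genAction_e_tmul, genAction_k_tmul, map_add, ← mul_smul, k_mul_e, smul_assoc,
      D.k_mul_k i j, smul_add, TensorProduct.tmul_smul, TensorProduct.smul_tmul']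

variable {z₀ : Z} {ζ : P} {v₀ : V} {ν : P} {BZ : LinearMap.BilinForm ℂ Z}

theorem IsShapovalovForm.contract_genAction_e (hB : D.IsShapovalovForm z₀ BZ) (i : I)
    (u : V ⊗[ℂ] Z) (y : Z) : contract V BZ (D.genAction V Z (.e i) u) y
      = D.e i • contract V BZ u (D.k i • y) - contract V BZ u (D.f i • D.k i • y) := by
  induction u with
  | zero => simp
  | add x y hx hy => simp only [map_add, LinearMap.add_apply, hx, hy, smul_add]; abel
  | tmul v z =>
    simp only [genAction_e_tmul, map_add, LinearMap.add_apply, contract_tmul]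
    rw [hB.contravariant, hB.contravariant, omega_k, omega_e, neg_smul, map_neg, mul_smul, neg_smul,
      smul_algebra_smul_comm, sub_eq_add_neg]

/-- The contraction of `e_α u` is the defect of intertwining evaluated at `q ^ {h_α} y`. As `q ^
{h_α}` is invertible and contraction is injective, the vector vanishes exactly when the defect does.
-/
theorem IsShapovalovForm.genAction_e_eq_zero_iff [IsSimpleModule D.Uq Z]
    (hB : D.IsShapovalovForm z₀ BZ) (i : I) (u : V ⊗[ℂ] Z) :
    D.genAction V Z (.e i) u = 0
      ↔ ∀ y, contract V BZ u (D.f i • y) = D.e i • contract V BZ u y := by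
  constructor
  · intro h y
    have := hB.contract_genAction_e i u (D.kinv i • y)
    rw [h, map_zero, LinearMap.zero_apply, ← mul_smul (D.k i), k_mul_kinv, one_smul] at this
    exact (sub_eq_zero.mp this.symm).symm
  · intro h
    refine contract_injective (fun z hz => hB.eq_zero_of_forall hz) ?_
    ext y
    rw [hB.contract_genAction_e, h, sub_self, map_zero, LinearMap.zero_apply]

theorem smul_eq_sigma_smul_of_mem_UqMinus {ψ : Z → V}
    (hadd : ∀ x y, ψ (x + y) = ψ x + ψ y) (hsmul : ∀ (c : ℂ) x, ψ (c • x) = c • ψ x)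
    (h : ∀ i y, ψ (D.f i • y) = D.e i • ψ y) {x : D.Uq} (hx : x ∈ D.UqMinus) (y : Z) :
    ψ (x • y) = D.sigma x • ψ y := by
  induction hx using Algebra.adjoin_induction generalizing y with
  | mem x hx => obtain ⟨i, rfl⟩ := hx; rw [h, sigma_f]
  | algebraMap c => rw [algebraMap_smul, hsmul, AlgHom.commutes, algebraMap_smul]
  | add a b _ _ ha hb => rw [add_smul, hadd, ha, hb, map_add, add_smul]
  | mul a b _ _ ha hb => rw [mul_smul, ha, hb, map_mul, mul_smul]

/-! ### Singular vectors -/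

theorem tmul_mem_jointEigenspace {μ μ' : P} {v : V} {z : Z} (hv : v ∈ D.weightSpace V μ)
    (hz : z ∈ D.weightSpace Z μ') : v ⊗ₜ[ℂ] z ∈ jointEigenspace
      (fun i => D.genAction V Z (.k i)) (fun i => D.qpow (D.form (D.root i) (μ + μ'))) := by
  refine mem_jointEigenspace.mpr fun i => ?_
  rw [genAction_k_tmul, hv i, hz i, TensorProduct.smul_tmul_smul, map_add, qpow_add]

theorem mem_iSup_jointEigenspace (hV : D.IsHighestWeight v₀ ν) (hZ : D.IsHighestWeight z₀ ζ)
    (u : V ⊗[ℂ] Z) : u ∈ ⨆ χ : Set.range fun (μ : P) i => D.qpow (D.form (D.root i) μ),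
      jointEigenspace (fun i => D.genAction V Z (.k i)) χ := by
  induction u with
  | zero => exact zero_mem _
  | add x y hx hy => exact add_mem hx hy
  | tmul v z =>
    induction v using hV.fWord_induction with
    | hzero => simp
    | hadd x y hx hy => rw [TensorProduct.add_tmul]; exact add_mem hx hy
    | hsmul c x hx => rw [← TensorProduct.smul_tmul']; exact Submodule.smul_mem _ c hx
    | hw l =>
      induction z using hZ.fWord_induction with
      | hzero => simp
      | hadd x y hx hy => rw [TensorProduct.tmul_add]; exact add_mem hx hy
      | hsmul c x hx => rw [TensorProduct.tmul_smul]; exact Submodule.smul_mem _ c hx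
      | hw l' =>
        exact Submodule.mem_iSup_of_mem ⟨_, _, rfl⟩
          (tmul_mem_jointEigenspace (D.fWord_smul_mem_weightSpace l hV.mem_weightSpace)
            (D.fWord_smul_mem_weightSpace l' hZ.mem_weightSpace))

/-- The span of the singular vectors is the common kernel of the `e_α`. -/
theorem mem_singularSpace_iff (hV : D.IsHighestWeight v₀ ν) (hZ : D.IsHighestWeight z₀ ζ)
    {u : V ⊗[ℂ] Z} : u ∈ D.singularSpace V Z ↔ ∀ i, D.genAction V Z (.e i) u = 0 := by
  constructor
  · intro hu i
    induction hu using Submodule.span_induction with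
    | mem x hx => exact hx.2.2 i
    | zero => simp
    | add x y _ _ hx hy => simp [hx, hy]
    | smul c x _ hx => simp [hx]
  · intro hu
    -- Split `u` into joint eigenvectors of the `q ^ {h_α}` and show that each component is
    -- singular.
    obtain ⟨g, hg, rfl⟩ := (Submodule.mem_iSup_iff_exists_finsupp ..).mp
      (mem_iSup_jointEigenspace hV hZ u)
    refine Submodule.sum_mem _ fun χ hχ => ?_
    have hgχ := mem_jointEigenspace.mp (hg χ)
    refine Submodule.subset_span ⟨by simpa using hχ, ?_, fun i => ?_⟩
    · obtain ⟨⟨_, μ, rfl⟩, _⟩ := χ, hχ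
      exact ⟨μ, hgχ⟩
    -- Applying `e_i` multiplies every character by the same invertible `c`, so images of distinct
    -- components stay in distinct joint eigenspaces, and a zero sum forces each image to vanish.
    · let c : I → ℂ := fun j => D.qpow (D.form (D.root j) (D.root i))
      have hinj : Function.Injective fun χ : Set.range
          (fun (μ : P) i => D.qpow (D.form (D.root i) μ)) => c * χ.1 := fun χ χ' h => by
        refine Subtype.ext (funext fun j => mul_left_cancel₀ (D.qpow_ne_zero _) (congrFun h j))
      have hind := (iSupIndep_jointEigenspace
        (fun i j => commute_genAction_k (D := D) (V := V) (Z := Z) i j)).comp hinj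
      refine (iSupIndep_iff_finsetSum_eq_zero_imp_eq_zero _).mp hind g.support
        (fun χ => D.genAction V Z (.e i) (g χ)) (fun χ _ => ?_) ?_ χ hχ
      · refine mem_jointEigenspace.mpr fun j => ?_
        rw [genAction_k_e, mem_jointEigenspace.mp (hg χ) j, map_smul, smul_smul]
        rfl
      · rw [← map_sum]
        exact hu i

/-! ### Leading coefficients -/

omit [Module D.Uq V] [IsScalarTower ℂ D.Uq V] in
-- Pairing the second factor with `z₀` gives `v` on `v ⊗ z₀` and kills tensors of strictly lower
-- weight. Conversely, modulo such tensors every `f`-word in the second factor is a multiple of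
-- `z₀`.
theorem IsShapovalovForm.isLeadingCoeff_iff (hB : D.IsShapovalovForm z₀ BZ)
    (hs : D.SeparatesRoots) (hZ : D.IsHighestWeight z₀ ζ) {u : V ⊗[ℂ] Z} {v : V} :
    D.IsLeadingCoeff z₀ ζ u v ↔ contract V BZ u z₀ = v := by
  constructor
  · intro h
    have h1 : contract V BZ (u - v ⊗ₜ z₀) z₀ = 0 := by
      unfold IsLeadingCoeff at h
      generalize u - v ⊗ₜ z₀ = t at h
      induction h using Submodule.span_induction with
      | mem t ht =>
        obtain ⟨n, x, z, hn, hz, rfl⟩ := ht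
        rw [contract_tmul, hB.symm, hB.apply_weightSpace_eq_zero hs hZ hn hz, zero_smul]
      | zero => simp
      | add x y _ _ hx hy => simp [hx, hy]
      | smul c x _ hx => simp [hx]
    rwa [map_sub, LinearMap.sub_apply, contract_tmul, hB.normalized, one_smul, sub_eq_zero] at h1
  · rintro rfl
    unfold IsLeadingCoeff
    induction u with
    | zero => simp
    | add x y hx hy =>
      rw [map_add, LinearMap.add_apply, TensorProduct.add_tmul, add_sub_add_comm]
      exact add_mem hx hy
    | tmul x z =>
      rw [contract_tmul, TensorProduct.smul_tmul, ← TensorProduct.tmul_sub]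
      induction z using hZ.fWord_induction with
      | hzero => simp
      | hadd a b ha hb =>
        rw [map_add, LinearMap.add_apply, add_smul, add_sub_add_comm, TensorProduct.tmul_add]
        exact add_mem ha hb
      | hsmul c a ha =>
        rw [map_smul, LinearMap.smul_apply, smul_assoc, ← smul_sub, TensorProduct.tmul_smul]
        exact Submodule.smul_mem _ c ha
      | hw l =>
        cases l with
        | nil => simp [hB.normalized]
        | cons i l =>
          have h0 : BZ (D.fWord (i :: l) • z₀) z₀ = 0 := by
            rw [hB.symm, fWord_cons, mul_smul, (hB.isVacuum hZ).apply_f]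
          rw [h0, zero_smul, sub_zero]
          exact Submodule.subset_span ⟨_, x, _, content_cons_ne_zero i l,
            D.fWord_smul_mem_weightSpace _ hZ.mem_weightSpace, rfl⟩

theorem fWord_mem_UqMinus (l : List I) : D.fWord l ∈ D.UqMinus := by
  refine D.UqMinus.list_prod_mem fun x hx => ?_
  obtain ⟨i, -, rfl⟩ := List.mem_map.mp hx
  exact Algebra.subset_adjoin ⟨i, rfl⟩

/-- The map `U_q(𝔤_-) → Z`, `f ↦ f z₀`. -/
def minusOrbit (z₀ : Z) : D.UqMinus →ₗ[ℂ] Z :=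
  (Algebra.lsmul ℂ ℂ Z).toLinearMap.flip z₀ ∘ₗ D.UqMinus.val.toLinearMap

@[simp] theorem minusOrbit_apply (x : D.UqMinus) : minusOrbit z₀ x = (x : D.Uq) • z₀ := rfl

theorem IsHighestWeight.range_minusOrbit (hZ : D.IsHighestWeight z₀ ζ) :
    LinearMap.range (minusOrbit (D := D) z₀) = ⊤ := by
  refine top_le_iff.mp (hZ.span_fWord_smul.symm.le.trans (Submodule.span_le.mpr ?_))
  rintro _ ⟨l, rfl⟩
  exact ⟨⟨D.fWord l, fWord_mem_UqMinus l⟩, rfl⟩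

theorem IsHighestWeight.exists_UqMinus_smul_eq (hZ : D.IsHighestWeight z₀ ζ) (z : Z) :
    ∃ x ∈ D.UqMinus, x • z₀ = z := by
  obtain ⟨x, hx⟩ := LinearMap.range_eq_top.mp hZ.range_minusOrbit z
  exact ⟨x, x.2, hx⟩

/-- A vector of the extremal space defines an intertwining map on `Z`. -/
theorem IsHighestWeight.exists_intertwiner (hZ : D.IsHighestWeight z₀ ζ) {v : V}
    (hv : v ∈ D.extremalSpace V z₀) :
    ∃ ψ : Z →ₗ[ℂ] V, ∀ x ∈ D.UqMinus, ψ (x • z₀) = D.sigma x • v := by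
  obtain ⟨s, hs⟩ := (minusOrbit (D := D) z₀).exists_rightInverse_of_surjective
    hZ.range_minusOrbit
  refine ⟨(Algebra.lsmul ℂ ℂ V).toLinearMap.flip v ∘ₗ D.sigma.toLinearMap ∘ₗ
    D.UqMinus.val.toLinearMap ∘ₗ s, fun x hx => ?_⟩
  change D.sigma (s (x • z₀) : D.Uq) • v = _
  rw [← sub_eq_zero, ← sub_smul, ← map_sub]
  -- The chosen representative and `x` differ by an element of `I⁻_Z`, whose image under `σ` kills
  -- `v`.
  refine hv _ ⟨_, ⟨sub_mem (s (x • z₀)).2 hx, ?_⟩, rfl⟩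
  have : (s (x • z₀) : D.Uq) • z₀ = x • z₀ := LinearMap.congr_fun hs (x • z₀)
  rw [sub_smul, this, sub_self]

/-- The Shapovalov form is non-degenerate on every step of the filtration by length. -/
theorem IsShapovalovForm.nondegenerate_restrict [IsSimpleModule D.Uq Z]
    (hB : D.IsShapovalovForm z₀ BZ) (hZ : D.IsHighestWeight z₀ ζ) (m : ℕ) :
    (LinearMap.BilinForm.restrict BZ (D.wordFiltration z₀ m)).Nondegenerate := by
  have hrefl : (LinearMap.BilinForm.restrict BZ (D.wordFiltration z₀ m)).IsRefl :=
    fun x y h => (hB.symm y x).trans h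
  refine (LinearMap.IsRefl.nondegenerate_iff_separatingLeft hrefl).mpr fun y hy => ?_
  refine Subtype.ext (hB.eq_zero_of_forall fun w => ?_)
  -- Words of length at least `m` are orthogonal to the whole filtration step, so a vector in the
  -- radical of the restricted form is in the radical of the full form.
  induction w using hZ.fWord_induction with
  | hzero => simp
  | hadd a b ha hb => rw [map_add, ha, hb, add_zero]
  | hsmul c a ha => rw [map_smul, ha, smul_zero]
  | hw l =>
    by_cases hl : l.length < m
    · exact hy ⟨_, Submodule.subset_span ⟨l, hl, rfl⟩⟩
    · rw [hB.symm]
      exact hB.fWord_apply_eq_zero hZ l (wordFiltration_mono (not_lt.mp hl) y.2)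

omit [Module D.Uq V] [IsScalarTower ℂ D.Uq V] in
-- The tensor is a truncated canonical element: `∑ ψ(b_j) ⊗ d_j` for dual bases of the span of words
-- shorter than `m`. On longer words both `ψ` and the contraction vanish.
theorem IsShapovalovForm.exists_contract_eq [Finite I] [IsSimpleModule D.Uq Z]
    (hB : D.IsShapovalovForm z₀ BZ) (hZ : D.IsHighestWeight z₀ ζ) {m : ℕ} {ψ : Z →ₗ[ℂ] V}
    (hψ : ∀ l : List I, m ≤ l.length → ψ (D.fWord l • z₀) = 0) :
    ∃ u, contract V BZ u = ψ := by
  let F := D.wordFiltration z₀ m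
  have hnd := hB.nondegenerate_restrict hZ m
  let b := Module.finBasis ℂ F
  let d := LinearMap.BilinForm.dualBasis _ hnd b
  have hd (j k) : BZ (d j) (b k) = if k = j then 1 else 0 :=
    LinearMap.BilinForm.apply_dualBasis_left hnd b j k
  let u : V ⊗[ℂ] Z := ∑ j, ψ (b j) ⊗ₜ (d j : Z)
  have hu : ∀ y : F, contract V BZ u y = ψ y := by
    have : (contract V BZ u).comp F.subtype = ψ.comp F.subtype := by
      refine b.ext fun k => ?_
      simp [u, hd]
    exact LinearMap.congr_fun this
  refine ⟨u, LinearMap.ext fun w => ?_⟩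
  induction w using hZ.fWord_induction with
  | hzero => simp
  | hadd a b ha hb => rw [map_add, map_add, ha, hb]
  | hsmul c a ha => rw [map_smul, map_smul, ha]
  | hw l =>
    by_cases hl : l.length < m
    · exact hu ⟨_, Submodule.subset_span ⟨l, hl, rfl⟩⟩
    · rw [hψ l (not_lt.mp hl)]
      have h0 (j) : BZ (d j) (D.fWord l • z₀) = 0 := by
        rw [hB.symm]
        exact hB.fWord_apply_eq_zero hZ l (wordFiltration_mono (not_lt.mp hl) (d j).2)
      simp [u, h0]

variable [IsSimpleModule D.Uq Z]

theorem IsShapovalovForm.contract_smul (hB : D.IsShapovalovForm z₀ BZ)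
    (hV : D.IsHighestWeight v₀ ν) (hZ : D.IsHighestWeight z₀ ζ) {u : V ⊗[ℂ] Z}
    (hu : u ∈ D.singularSpace V Z) {x : D.Uq} (hx : x ∈ D.UqMinus) (y : Z) :
    contract V BZ u (x • y) = D.sigma x • contract V BZ u y :=
  smul_eq_sigma_smul_of_mem_UqMinus (map_add _) (map_smul _)
    (fun i => (hB.genAction_e_eq_zero_iff i u).mp ((mem_singularSpace_iff hV hZ).mp hu i)) hx y

/-- The leading coefficient is an isomorphism from `(V ⊗ Z)⁺` to `V⁺_Z`. -/
theorem IsShapovalovForm.exists_leadingCoeffEquiv [Finite I] (hB : D.IsShapovalovForm z₀ BZ)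
    (hV : D.IsHighestWeight v₀ ν) (hZ : D.IsHighestWeight z₀ ζ) :
    ∃ δ : D.extremalSpace V z₀ ≃ₗ[ℂ] D.singularSpace V Z,
      ∀ u, (δ.symm u : V) = contract V BZ u z₀ := by
  let Λ : D.singularSpace V Z →ₗ[ℂ] D.extremalSpace V z₀ :=
    (((contract V BZ).flip z₀).comp (D.singularSpace V Z).subtype).codRestrict _ (by
      rintro u _ ⟨x, ⟨hx, hx0⟩, rfl⟩
      change D.sigma x • contract V BZ u z₀ = 0
      -- For `x ∈ I⁻_Z` the intertwining property gives `σ(x) ψ_u(z₀) = ψ_u(x z₀) = 0`, so leading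
      -- coefficients lie in the extremal space.
      rw [← hB.contract_smul hV hZ u.2 hx, hx0, map_zero])
  have hΛ (u) : (Λ u : V) = contract V BZ u z₀ := rfl
  have hinj : Function.Injective Λ := by
    refine (injective_iff_map_eq_zero _).mpr fun u hu => Subtype.ext ?_
    refine contract_injective (fun z hz => hB.eq_zero_of_forall hz) (LinearMap.ext fun y => ?_)
    obtain ⟨x, hx, rfl⟩ := hZ.exists_UqMinus_smul_eq y
    rw [hB.contract_smul hV hZ u.2 hx, ← hΛ, hu]
    simp
  have hsurj : Function.Surjective Λ := by
    rintro ⟨v, hv⟩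
    obtain ⟨ψ, hψ⟩ := hZ.exists_intertwiner hv
    -- The truncation length comes from `V`: any `m` `e`-letters annihilate `v`, so the intertwiner
    -- is zero on `f`-words of length at least `m`.
    obtain ⟨m, hm⟩ := hV.exists_mem_wordFiltration v
    obtain ⟨u, hu⟩ := hB.exists_contract_eq hZ (m := m) (ψ := ψ) fun l hl => by
      rw [hψ _ (fWord_mem_UqMinus l), sigma_fWord, hV.eWord_smul_eq_zero hl hm]
    refine ⟨⟨u, (mem_singularSpace_iff hV hZ).mpr fun i =>
      (hB.genAction_e_eq_zero_iff i u).mpr fun y => ?_⟩, Subtype.ext ?_⟩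
    · obtain ⟨x, hx, rfl⟩ := hZ.exists_UqMinus_smul_eq y
      rw [hu, ← mul_smul, hψ x hx, hψ _ (mul_mem (Algebra.subset_adjoin ⟨i, rfl⟩) hx), map_mul,
        sigma_f, mul_smul]
    · have := hψ 1 (one_mem _)
      rw [one_smul, map_one, one_smul] at this
      rw [hΛ, hu, this]
  exact ⟨(LinearEquiv.ofBijective Λ ⟨hinj, hsurj⟩).symm, fun u => rfl⟩

omit [IsSimpleModule D.Uq Z] in
theorem IsDeltaL.eq_of_isDeltaL {δ δ' : D.extremalSpace V z₀ ≃ₗ[ℂ] D.singularSpace V Z}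
    (h : D.IsDeltaL z₀ ζ δ) (h' : D.IsDeltaL z₀ ζ δ') : δ' = δ := by
  have : δ'.symm = δ.symm := LinearEquiv.ext fun u =>
    Subtype.ext ((h' u _).mp ((h u _).mpr rfl))
  rw [← δ'.symm_symm, this, δ.symm_symm]

theorem IsShapovalovForm.existsUnique_isDeltaL [Finite I] (hB : D.IsShapovalovForm z₀ BZ)
    (hs : D.SeparatesRoots) (hV : D.IsHighestWeight v₀ ν) (hZ : D.IsHighestWeight z₀ ζ) :
    ∃! δ : D.extremalSpace V z₀ ≃ₗ[ℂ] D.singularSpace V Z, D.IsDeltaL z₀ ζ δ := by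
  obtain ⟨δ, hδ⟩ := hB.exists_leadingCoeffEquiv hV hZ
  have : D.IsDeltaL z₀ ζ δ := fun u v => by rw [hB.isLeadingCoeff_iff hs hZ, hδ]
  exact ⟨δ, this, fun δ' h' => this.eq_of_isDeltaL h'⟩

/-! ### The extremal twist -/

omit [Module D.Uq V] [IsScalarTower ℂ D.Uq V] in
omit [IsSimpleModule D.Uq Z] in
theorem evalLift_surjective (hZ : D.IsHighestWeight z₀ ζ) :
    Function.Surjective (D.evalLift (V := V) z₀) :=
  LinearMap.lTensor_surjective V (LinearMap.range_eq_top.mp hZ.range_minusOrbit)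

omit [IsSimpleModule D.Uq Z] in
-- By right exactness of the tensor product, two lifts differ by an element of the image of `V ⊗
-- I⁻_Z`, and there `γ⁻¹(x) v = ω(σ(x)) v`.
theorem twistLift_mem_extremalPerp (hZ : D.IsHighestWeight z₀ ζ) {t : V ⊗[ℂ] D.UqMinus}
    (ht : D.evalLift z₀ t = 0) : D.twistLift t ∈ D.extremalPerp V z₀ := by
  obtain ⟨s, rfl⟩ := (lTensor_exact V (LinearMap.exact_subtype_ker_map (minusOrbit (D := D) z₀))
    (LinearMap.range_eq_top.mp hZ.range_minusOrbit) t).mp ht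
  clear ht
  induction s with
  | zero => simp
  | add x y hx hy =>
    rw [map_add, map_add]
    exact add_mem hx hy
  | tmul v x =>
    refine Submodule.subset_span ⟨D.sigma x.1, ⟨x.1, ⟨x.1.2, x.2⟩, rfl⟩, v, ?_⟩
    rw [omega_sigma]
    rfl

omit [IsSimpleModule D.Uq Z] in
-- A linear section of `evalLift` makes the choice of lifts linear; projecting along `V^⊥_Z` then
-- removes the dependence on that choice.
theorem existsUnique_isExtremalTwist (hZ : D.IsHighestWeight z₀ ζ)
    (δ : D.extremalSpace V z₀ ≃ₗ[ℂ] D.singularSpace V Z) {C : Submodule ℂ V}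
    (hC : IsCompl C (D.extremalPerp V z₀)) :
    ∃! θ : D.extremalSpace V z₀ →ₗ[ℂ] C, D.IsExtremalTwist z₀ δ hC θ := by
  obtain ⟨s, hs⟩ := (D.evalLift (V := V) z₀).exists_rightInverse_of_surjective
    (LinearMap.range_eq_top.mpr (evalLift_surjective hZ))
  have hs' (u) : D.evalLift z₀ (s u) = u := LinearMap.congr_fun hs u
  refine ⟨Submodule.projectionOnto C _ hC ∘ₗ D.twistLift ∘ₗ s ∘ₗ (D.singularSpace V Z).subtype ∘ₗ
    δ.toLinearMap, ⟨fun v => evalLift_surjective hZ _, fun v t ht => ?_⟩, fun θ hθ => ?_⟩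
  · change Submodule.projectionOnto C _ hC (D.twistLift (s (δ v : V ⊗[ℂ] Z))) = _
    rw [← sub_eq_zero, ← map_sub, ← map_sub, Submodule.projectionOnto_apply_eq_zero_iff]
    exact twistLift_mem_extremalPerp hZ (by rw [map_sub, hs', ht, sub_self])
  · ext v
    rw [hθ.eq_of_lift v _ (hs' _)]
    rfl

variable {BV : LinearMap.BilinForm ℂ V}

omit [IsSimpleModule D.Uq Z] in
theorem IsShapovalovForm.apply_extremalPerp_eq_zero (hBV : D.IsShapovalovForm v₀ BV) {v w : V}
    (hv : v ∈ D.extremalPerp V z₀) (hw : w ∈ D.extremalSpace V z₀) : BV v w = 0 := by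
  induction hv using Submodule.span_induction with
  | mem v hv =>
    obtain ⟨x, hx, v, rfl⟩ := hv
    rw [hBV.contravariant, omega_omega, hw x hx, map_zero]
  | zero => simp
  | add x y _ _ hx hy => simp [hx, hy]
  | smul c x _ hx => simp [hx]

/-- On a pure tensor `v ⊗ x`, the element `x` passes through the contraction as `σ(x)`, and
contravariance on `V` moves it to `v` as `ω(σ(x)) = γ⁻¹(x)`. -/
theorem IsShapovalovForm.canonicalForm_evalLift (hBV : D.IsShapovalovForm v₀ BV)
    (hBZ : D.IsShapovalovForm z₀ BZ) (hV : D.IsHighestWeight v₀ ν) (hZ : D.IsHighestWeight z₀ ζ)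
    (t : V ⊗[ℂ] D.UqMinus) {u : V ⊗[ℂ] Z} (hu : u ∈ D.singularSpace V Z) :
    canonicalForm BV BZ (D.evalLift z₀ t) u = BV (D.twistLift t) (contract V BZ u z₀) := by
  have key (v : V) (z : Z) (u : V ⊗[ℂ] Z) :
      canonicalForm BV BZ (v ⊗ₜ z) u = BV v (contract V BZ u z) := by
    induction u with
    | zero => simp
    | add x y hx hy => simp [hx, hy]
    | tmul w y => rw [canonicalForm_tmul, contract_tmul, map_smul, hBZ.symm, smul_eq_mul, mul_comm]
  induction t with
  | zero => simp
  | add x y hx hy => simp [hx, hy]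
  | tmul v x =>
    change canonicalForm BV BZ (v ⊗ₜ ((x : D.Uq) • z₀)) u
      = BV (D.antipodeInv (x : D.Uq) • v) _
    rw [key, hBZ.contract_smul hV hZ hu x.2, hBV.contravariant', omega_sigma]

theorem IsExtremalTwist.canonicalForm_eq (hBV : D.IsShapovalovForm v₀ BV)
    (hBZ : D.IsShapovalovForm z₀ BZ) (hs : D.SeparatesRoots) (hV : D.IsHighestWeight v₀ ν)
    (hZ : D.IsHighestWeight z₀ ζ) {δ : D.extremalSpace V z₀ ≃ₗ[ℂ] D.singularSpace V Z}
    (hδ : D.IsDeltaL z₀ ζ δ) {C : Submodule ℂ V} {hC : IsCompl C (D.extremalPerp V z₀)}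
    {θ : D.extremalSpace V z₀ →ₗ[ℂ] C} (hθ : D.IsExtremalTwist z₀ δ hC θ)
    (v w : D.extremalSpace V z₀) :
    canonicalForm BV BZ (δ v : V ⊗[ℂ] Z) (δ w : V ⊗[ℂ] Z) = BV (θ v : V) (w : V) := by
  obtain ⟨t, ht⟩ := hθ.exists_lift v
  have hw : contract V BZ (δ w : V ⊗[ℂ] Z) z₀ = w :=
    (hBZ.isLeadingCoeff_iff hs hZ).mp ((hδ (δ w) w).mpr (by simp))
  rw [← ht, hBV.canonicalForm_evalLift hBZ hV hZ t (δ w).2, hw, hθ.eq_of_lift v t ht,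
    ← sub_eq_zero, ← LinearMap.sub_apply, ← map_sub]
  -- A vector and its projection differ by an element of `V^⊥_Z`, which does not pair with `w`.
  refine hBV.apply_extremalPerp_eq_zero ?_ w.2
  rw [← Submodule.projectionOnto_apply_eq_zero_iff hC, map_sub,
    Submodule.projectionOnto_apply_left, sub_self]

end TwoModules
end QuantumDatum

/-! ### Separation of weights for a semisimple Lie algebra -/

section Lie

variable {L : Type*} [LieRing L] [LieAlgebra ℂ L] [FiniteDimensional ℂ L]
  [LieAlgebra.IsSemisimple ℂ L] {H : LieSubalgebra ℂ L} [H.IsCartanSubalgebra]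

/-- The coroot is twice the vector dual to the root, divided by the squared length; the scale `κ⁻¹`
occurs once on each side. -/
theorem two_mul_dualForm_root (κ : ℂ) (i : H.root) (x : Module.Dual ℂ H) :
    2 * dualForm H κ ((LieAlgebra.IsKilling.rootSystem H).root i) x
      = dualForm H κ ((LieAlgebra.IsKilling.rootSystem H).root i)
          ((LieAlgebra.IsKilling.rootSystem H).root i)
        * x ((LieAlgebra.IsKilling.rootSystem H).coroot i) := by
  have hne := LieAlgebra.IsKilling.root_apply_cartanEquivDual_symm_ne_zero
    (α := (i : LieModule.Weight ℂ H L)) ((Finset.mem_filter.mp i.2).2)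
  rw [dualForm_symm, dualForm_apply, dualForm_apply,
    LieAlgebra.IsKilling.rootSystem_coroot_apply, LieAlgebra.IsKilling.coroot, map_nsmul, map_smul,
    LieAlgebra.IsKilling.rootSystem_root_apply]
  simp only [LieModule.Weight.toLinear_apply, nsmul_eq_mul, smul_eq_mul, Nat.cast_ofNat]
  field_simp

/-- If all `q ^ {(α_i, x)}` were `1`, the integers `x(α_i^∨)` would be exponents killing `q ^ {(α_i,
α_i)}`, hence zero. Simple coroots span `𝔥`, so `x = 0`, and independence of the simple roots gives
`n = 0`. -/
theorem separatesRoots_quantumDatum (b : (LieAlgebra.IsKilling.rootSystem H).Base) (κ ħ : ℂ)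
    (hq : ∀ (i : b.support) (n : ℕ), 0 < n → (quantumDatum b κ ħ).qpow
      ((quantumDatum b κ ħ).form ((quantumDatum b κ ħ).root i) ((quantumDatum b κ ħ).root i)) ^ n
        ≠ 1) : (quantumDatum b κ ħ).SeparatesRoots := by
  set D := quantumDatum b κ ħ with hD
  let R := LieAlgebra.IsKilling.rootSystem H
  intro n hn
  by_contra! hall
  set x : Module.Dual ℂ H := n.sum fun j a => a • D.root j with hx
  have hint (i : b.support) : ∃ m : ℤ, x (R.coroot i) = m := by
    choose m hm using fun j : b.support => (⟨_, LieAlgebra.IsKilling.apply_coroot_eq_cast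
      (i : H.root).1 (j : H.root).1⟩ : ∃ m : ℤ, (j : H.root).1 (LieAlgebra.IsKilling.coroot _) = m)
    refine ⟨n.sum fun j a => a * m j, ?_⟩
    rw [hx, Finsupp.sum, Finsupp.sum, LinearMap.sum_apply, Int.cast_sum]
    refine Finset.sum_congr rfl fun j _ => ?_
    have h1 : D.root j (R.coroot i) = m j := hm j
    rw [LinearMap.smul_apply, h1]
    simp
  have hzero (i : b.support) : x (R.coroot i) = 0 := by
    obtain ⟨m, hm⟩ := hint i
    have h2 : D.form (D.root i) x * 2 = D.form (D.root i) (D.root i) * m := by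
      rw [mul_comm, ← hm]
      exact two_mul_dualForm_root κ i.1 x
    -- The square of `q ^ {(α_i, x)}` is taken because `m (α_i, α_i) = 2 (α_i, x)`; this avoids
    -- choosing a square root of `q ^ {(α_i, α_i)}`.
    have h3 : D.qpow (D.form (D.root i) (D.root i)) ^ m = 1 := by
      have : D.qpow (D.form (D.root i) x) ^ 2 = 1 := by rw [hall i, one_pow]
      rw [← this, QuantumDatum.qpow, QuantumDatum.qpow, ← Complex.exp_int_mul, ← Complex.exp_nat_mul]
      congr 1
      push_cast
      linear_combination -D.hbar * h2
    rw [hm]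
    by_contra hm0
    have hm0 : m ≠ 0 := by simpa using hm0
    refine hq i m.natAbs (Int.natAbs_pos.mpr hm0) ?_
    obtain h | h := Int.natAbs_eq m
    · rw [h, zpow_natCast] at h3; exact h3
    · rw [h, zpow_neg, zpow_natCast, inv_eq_one] at h3; exact h3
  have hx0 : x = 0 := by
    have hspan : (⊤ : Submodule ℂ H) ≤ LinearMap.ker x := by
      rw [← RootPairing.IsRootSystem.span_coroot_eq_top (P := R)]
      refine b.span_coroot_support.symm.le.trans (Submodule.span_le.mpr ?_)
      rintro _ ⟨i, hi, rfl⟩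
      exact hzero ⟨i, hi⟩
    exact LinearMap.ext fun h => hspan Submodule.mem_top
  have hli : LinearIndependent ℂ D.root := b.linearIndepOn_root
  refine hn (Finsupp.ext fun j => ?_)
  have h1 : Finsupp.linearCombination ℂ D.root (n.mapRange Nat.cast Nat.cast_zero) = 0 := by
    rw [Finsupp.linearCombination_apply, Finsupp.sum_mapRange_index (by simp), ← hx0, hx]
    simp [Nat.cast_smul_eq_nsmul]
  have := DFunLike.congr_fun (linearIndependent_iff.mp hli _ h1) j
  simpa using this

end Lie

end

theorem mainTheorem3 {L : Type*} [LieRing L] [LieAlgebra ℂ L] [FiniteDimensional ℂ L]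
    [LieAlgebra.IsSemisimple ℂ L] (H : LieSubalgebra ℂ L) [H.IsCartanSubalgebra]
    (b : (LieAlgebra.IsKilling.rootSystem H).Base) (κ ħ : ℂ) (hκ : κ ≠ 0)
    (D : QuantumDatum b.support (Module.Dual ℂ H)) (hD : D = quantumDatum b κ ħ)
    (hq : ∀ n : ℕ, 0 < n → D.q ^ n ≠ 1)
    (hqα : ∀ (i : b.support) (n : ℕ), 0 < n →
      D.qpow (D.form (D.root i) (D.root i)) ^ n ≠ 1)
    {V Z : Type*} [AddCommGroup V] [Module ℂ V] [Module D.Uq V] [IsScalarTower ℂ D.Uq V]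
    [AddCommGroup Z] [Module ℂ Z] [Module D.Uq Z] [IsScalarTower ℂ D.Uq Z]
    [IsSimpleModule D.Uq V] [IsSimpleModule D.Uq Z]
    (ν ζ : Module.Dual ℂ H) (v₀ : V) (z₀ : Z)
    (hV : D.IsHighestWeight v₀ ν) (hZ : D.IsHighestWeight z₀ ζ) :
    (∃! BV, D.IsShapovalovForm v₀ BV) ∧ (∃! BZ, D.IsShapovalovForm z₀ BZ) ∧
    (∃! δ : D.extremalSpace V z₀ ≃ₗ[ℂ] D.singularSpace V Z, D.IsDeltaL z₀ ζ δ) ∧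
    ∀ δ : D.extremalSpace V z₀ ≃ₗ[ℂ] D.singularSpace V Z, D.IsDeltaL z₀ ζ δ →
      ∀ (C : Submodule ℂ V) (hC : IsCompl C (D.extremalPerp V z₀)),
        (∃! θ : D.extremalSpace V z₀ →ₗ[ℂ] C, D.IsExtremalTwist z₀ δ hC θ) ∧
        ∀ θ : D.extremalSpace V z₀ →ₗ[ℂ] C, D.IsExtremalTwist z₀ δ hC θ →
          ∀ BV BZ, D.IsShapovalovForm v₀ BV → D.IsShapovalovForm z₀ BZ →
            ∀ v w : D.extremalSpace V z₀,
              QuantumDatum.canonicalForm BV BZ (δ v : V ⊗[ℂ] Z) (δ w : V ⊗[ℂ] Z)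
                = BV (θ v : V) (w : V) := by
  subst hD
  have hs := separatesRoots_quantumDatum b κ ħ hqα
  obtain ⟨BV, hBV⟩ := hV.exists_isShapovalovForm hs
  obtain ⟨BZ, hBZ⟩ := hZ.exists_isShapovalovForm hs
  exact ⟨⟨BV, hBV, fun _ h => hBV.eq_of_isShapovalovForm hV h⟩,
    ⟨BZ, hBZ, fun _ h => hBZ.eq_of_isShapovalovForm hZ h⟩,
    hBZ.existsUnique_isDeltaL hs hV hZ,
    fun δ hδ C hC => ⟨QuantumDatum.existsUnique_isExtremalTwist hZ δ hC,
      fun θ hθ BV BZ hBV hBZ v w => hθ.canonicalForm_eq hBV hBZ hs hV hZ hδ v w⟩⟩
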